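/- Let $n\ge 2$ and let $\mathfrak g=\mathfrak{sl}(n+1,\mathbb H)$ (quaternionic matrices whose trace has real part $0$) with the grading $\mathfrak g=\mathfrak g_{-1}\oplus\mathfrak g_0\oplus\mathfrak g_1$ given by the blocks $\begin{pmatrix}a&p\\v&A\end{pmatrix}$ of sizes $1,n$: $\mathfrak g_{-1}=\{v\in\mathbb H^n\}$, $\mathfrak g_1=\{p\in\mathbb H^{*n}\}$, $\mathfrak g_0=\{(a,A):\operatorname{Re}a+\operatorname{Re}\operatorname{tr}A=0\}=\mathfrak{sp}(1)\oplus\mathbb RZ\oplus\mathfrak{sl}(n,\mathbb H)$, where $Z=\operatorname{diag}(\frac n{n+1},\frac{-1}{n+1},\dots,\frac{-1}{n+1})$. Let $H^2_2$ be the curvature module, i.e. the $\mathfrak g_0$-module formed by the homogeneity $2$ part of the Lie algebra cohomology $H^2(\mathfrak g_{-1},\mathfrak g)$ (the cohomology of $\operatorname{Hom}(\mathfrak g_{-1},\mathfrak g_1)\to\operatorname{Hom}(\Lambda^2\mathfrak g_{-1},\mathfrak g_0)\to\operatorname{Hom}(\Lambda^3\mathfrak g_{-1},\mathfrak g_{-1})$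 at the middle term). Let $Z'\in\mathfrak{sl}(n,\mathbb H)$ be $\operatorname{diag}(1,0,\dots,0,-1)$ if $n>2$ and $\operatorname{diag}(\frac12,-\frac12)$ if $n=2$. An element of $H^2_2$ is called extremal if it lies in the eigenspace of $Z'$ for the largest eigenvalue $\theta_{\max}$ of $Z'$ on $H^2_2$. Let $\mathfrak{heis}(8n-12,\mathbb H)$ be the Lie algebra of $n\times n$ quaternionic matrices with zero diagonal and zeros outside the first row and the last column. Then nonzero extremal elements exist, and if $w$ is a nonzero extremal element whose annihilator $\mathfrak{ann}(w)=\{A\in\mathfrak g_0:A\cdot w=0\}$ has the largest dimension among all nonzero extremal elements, then, as an internal direct and semidirect sum of subalgebras of $\mathfrak g_0$, $$\mathfrak{ann}(w)=\mathfrak{sp}(1)\oplus\bigl(\mathfrak{so}(2)\oplus\mathbb R\oplus\mathfrak{gl}(n-2,\mathbb H)\bigr)\ltimes\mathfrak{heis}(8n-12,\mathbb H).$$ Here $\mathfrak{sp}(1)$ is the summand of $\mathfrak g_0$; $\mathfrak{so}(2)$ is contained in $\mathfrak{sp}(1)_{\rm left}\oplus\mathfrak{sp}(1)_{\rm right}$,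 the imaginary quaternions in the first and in the last diagonal entry of $A$; $\mathbb R$ is spanned by a linear combination of $Z$ and $Z'$; $\mathfrak{gl}(n-2,\mathbb H)$ is embedded in $\mathfrak g_0$ so that the middle $(n-2)\times(n-2)$ block of $A$ is the given matrix; and $\mathfrak{heis}(8n-12,\mathbb H)$, of real dimension $8n-12$, lies in $\mathfrak{sl}(n,\mathbb H)$ as described and is an ideal of $\mathfrak{ann}(w)$. The three summands $\mathfrak{so}(2)$, $\mathbb R$, $\mathfrak{gl}(n-2,\mathbb H)$ commute with one another, and $\mathfrak{sp}(1)$ commutes with the other four summands. Moreover the graded Lie algebra $\mathfrak g_{-1}\oplus\mathfrak{ann}(w)\subset\mathfrak g$, where $\mathfrak g_{-1}=\mathbb H^n$, has real dimension $4n^2-4n+9$. -/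

import Mathlib

open scoped Quaternion

noncomputable section

namespace AlmostQuaternionic

open LieModule.Cohomology

/-! ### The homogeneity 2 part of the second cohomology of a |1|-graded Lie algebra -/

/-- The pieces of a grading `𝔤 = 𝔤₋₁ ⊕ 𝔤₀ ⊕ 𝔤₁` of a real Lie algebra `L`, with those bracket
relations that are used to define the `𝔤₀`-module `H²₂`. -/
structure Grading (L : Type) [LieRing L] [LieAlgebra ℝ L] where
  gm1 : LieSubalgebra ℝ L
  g0 : LieSubalgebra ℝ L
  g1 : Submodule ℝ L
  gm1_abelian : ∀ {v w : L}, v ∈ gm1 → w ∈ gm1 → ⁅v, w⁆ = 0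
  lie_gm1 : ∀ {A v : L}, A ∈ g0 → v ∈ gm1 → ⁅A, v⁆ ∈ gm1
  lie_g1 : ∀ {A p : L}, A ∈ g0 → p ∈ g1 → ⁅A, p⁆ ∈ g1

section Cohomology

variable {L : Type} [LieRing L] [LieAlgebra ℝ L]

/-- The adjoint action of `𝔤₀` on `𝔤₋₁`. -/
instance (G : Grading L) : LieRingModule G.g0 G.gm1 where
  bracket A v := ⟨⁅A.1, v.1⁆, G.lie_gm1 A.2 v.2⟩
  add_lie A B v := Subtype.ext (add_lie A.1 B.1 v.1)
  lie_add A v w := Subtype.ext (lie_add A.1 v.1 w.1)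
  leibniz_lie A B v := Subtype.ext (leibniz_lie A.1 B.1 v.1)

instance (G : Grading L) : LieModule ℝ G.g0 G.gm1 where
  smul_lie t A v := Subtype.ext (smul_lie t A.1 v.1)
  lie_smul t A v := Subtype.ext (lie_smul t A.1 v.1)

theorem Grading.coe_lie {G : Grading L} (A : G.g0) (v : G.gm1) :
    (⁅A, v⁆ : G.gm1).1 = ⁅A.1, v.1⁆ := rfl

/-! A cochain on `Λᵏ𝔤₋₁` has homogeneity `2` iff it takes values in the part of `𝔤` of degree
`2 - k`, so `H²₂` is the cohomology at the middle of
`Hom(𝔤₋₁, 𝔤₁) → Hom(Λ²𝔤₋₁, 𝔤₀) → Hom(Λ³𝔤₋₁, 𝔤₋₁)`. The algebra `𝔤₀` acts on multilinear maps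
by `(A · φ)(x, y) = [A, φ(x, y)] - φ([A, x], y) - φ(x, [A, y])`. -/

theorem lie_cochain_apply {G : Grading L} (A : G.g0) (φ : G.gm1 →ₗ[ℝ] G.gm1 →ₗ[ℝ] L)
    (x y : G.gm1) : ⁅A, φ⁆ x y = ⁅A.1, φ x y⁆ - φ x ⁅A, y⁆ - φ ⁅A, x⁆ y := by
  rw [LieHom.lie_apply, LinearMap.sub_apply, LieHom.lie_apply]
  rfl

theorem lie_lie_left {G : Grading L} (A : G.g0) (x : G.gm1) (u : L) :
    ⁅x.1, ⁅A.1, u⁆⁆ = ⁅A.1, ⁅x.1, u⁆⁆ - ⁅(⁅A, x⁆ : G.gm1).1, u⁆ := by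
  rw [Grading.coe_lie, leibniz_lie A.1 x.1 u]
  abel

/-- The 2-cocycles of homogeneity `2`, as a `𝔤₀`-module. As `𝔤₋₁` is abelian, the terms
`φ([x, y], z)` of the Chevalley-Eilenberg differential vanish. -/
def cocycles₂ (G : Grading L) : LieSubmodule ℝ G.g0 (G.gm1 →ₗ[ℝ] G.gm1 →ₗ[ℝ] L) where
  carrier := {φ | (∀ x, φ x x = 0) ∧ (∀ x y, φ x y ∈ G.g0) ∧
    ∀ x y z, ⁅x.1, φ y z⁆ - ⁅y.1, φ x z⁆ + ⁅z.1, φ x y⁆ = 0}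
  add_mem' := by
    rintro φ ψ ⟨h1, h2, h3⟩ ⟨h1', h2', h3'⟩
    refine ⟨fun x => ?_, fun x y => ?_, fun x y z => ?_⟩
    · rw [LinearMap.add_apply, LinearMap.add_apply, h1, h1', add_zero]
    · rw [LinearMap.add_apply, LinearMap.add_apply]
      exact add_mem (h2 x y) (h2' x y)
    · simp only [LinearMap.add_apply, lie_add]
      rw [← add_zero (0 : L)]
      nth_rewrite 1 [← h3 x y z]
      rw [← h3' x y z]
      abel
  zero_mem' := by
    refine ⟨fun x => ?_, fun x y => ?_, fun x y z => ?_⟩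
    · simp only [LinearMap.zero_apply]
    · simp only [LinearMap.zero_apply]
      exact zero_mem _
    · simp only [LinearMap.zero_apply, lie_zero, sub_zero, add_zero]
  smul_mem' := by
    rintro t φ ⟨h1, h2, h3⟩
    refine ⟨fun x => ?_, fun x y => ?_, fun x y z => ?_⟩
    · rw [LinearMap.smul_apply, LinearMap.smul_apply, h1, smul_zero]
    · rw [LinearMap.smul_apply, LinearMap.smul_apply]
      exact (G.g0).smul_mem t (h2 x y)
    · simp only [LinearMap.smul_apply, lie_smul]
      rw [← smul_sub, ← smul_add, h3, smul_zero]
  lie_mem := by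
    rintro A φ ⟨h1, h2, h3⟩
    have hsk : ∀ x y, φ x y = -φ y x := fun x y => by
      have := h1 (x + y)
      rw [(φ (x + y)).map_add, φ.map_add, LinearMap.add_apply, LinearMap.add_apply, h1, h1,
        zero_add, add_zero] at this
      rw [add_comm] at this
      exact eq_neg_of_add_eq_zero_left this
    refine ⟨fun x => ?_, fun x y => ?_, fun x y z => ?_⟩
    · rw [lie_cochain_apply, h1, lie_zero, hsk x ⁅A, x⁆]
      abel
    · rw [lie_cochain_apply]
      exact sub_mem (sub_mem ((G.g0).lie_mem A.2 (h2 _ _)) (h2 _ _)) (h2 _ _)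
    · simp only [lie_cochain_apply, lie_sub, lie_lie_left]
      have e0 := congrArg (fun u => ⁅A.1, u⁆) (h3 x y z)
      simp only [lie_add, lie_sub, lie_zero] at e0
      have e1 := h3 ⁅A, x⁆ y z
      have e2 := h3 x ⁅A, y⁆ z
      have e3 := h3 x y ⁅A, z⁆
      have := congrArg₂ (fun u v : L => u - v) e0
        (congrArg₂ (fun u v : L => u + v) e1 (congrArg₂ (fun u v : L => u + v) e2 e3))
      simp only [add_zero, sub_zero] at this
      rw [← this]
      abel

/-- The coboundaries of 1-cochains of homogeneity `2`, as a `𝔤₀`-module. -/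
def coboundaries₂ (G : Grading L) : LieSubmodule ℝ G.g0 (G.gm1 →ₗ[ℝ] G.gm1 →ₗ[ℝ] L) where
  carrier := {φ | ∃ f : G.gm1 →ₗ[ℝ] L, (∀ x, f x ∈ G.g1) ∧
    ∀ x y, φ x y = ⁅x.1, f y⁆ - ⁅y.1, f x⁆}
  add_mem' := by
    rintro φ ψ ⟨f, hf, h⟩ ⟨f', hf', h'⟩
    refine ⟨f + f', fun x => ?_, fun x y => ?_⟩
    · rw [LinearMap.add_apply]
      exact add_mem (hf x) (hf' x)
    · simp only [LinearMap.add_apply, lie_add, h, h']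
      abel
  zero_mem' := by
    refine ⟨0, fun x => ?_, fun x y => ?_⟩
    · rw [LinearMap.zero_apply]
      exact zero_mem _
    · simp only [LinearMap.zero_apply, lie_zero, sub_zero]
  smul_mem' := by
    rintro t φ ⟨f, hf, h⟩
    refine ⟨t • f, fun x => ?_, fun x y => ?_⟩
    · rw [LinearMap.smul_apply]
      exact (G.g1).smul_mem t (hf x)
    · simp only [LinearMap.smul_apply, lie_smul, h, smul_sub]
  lie_mem := by
    rintro A φ ⟨f, hf, h⟩
    have hA : ∀ x, (⁅A, f⁆ : G.gm1 →ₗ[ℝ] L) x = ⁅A.1, f x⁆ - f ⁅A, x⁆ := fun x => by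
      rw [LieHom.lie_apply]
      rfl
    refine ⟨⁅A, f⁆, fun x => ?_, fun x y => ?_⟩
    · rw [hA]
      exact sub_mem (G.lie_g1 A.2 (hf x)) (hf _)
    · simp only [lie_cochain_apply, h, hA, lie_sub, lie_lie_left]
      abel

/-- `cocycles₂` consists of Mathlib's 2-cocycles with values in `𝔤₀`. -/
theorem mem_cocycles₂_iff {G : Grading L} (φ : G.gm1 →ₗ[ℝ] G.gm1 →ₗ[ℝ] L) :
    φ ∈ cocycles₂ G ↔
      (∃ c ∈ twoCocycle ℝ G.gm1 L, c.1 = φ) ∧ ∀ x y, φ x y ∈ G.g0 := by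
  have hab : ∀ x y : G.gm1, ⁅x, y⁆ = 0 := fun x y => Subtype.ext (G.gm1_abelian x.2 y.2)
  constructor
  · rintro ⟨h1, h2, h3⟩
    refine ⟨⟨⟨φ, h1⟩, ?_, rfl⟩, h2⟩
    rw [mem_twoCocycle_iff]
    ext x y z
    rw [d₂₃_apply, hab, hab, hab, map_zero]
    simp only [LinearMap.zero_apply, sub_zero, add_zero]
    exact h3 x y z
  · rintro ⟨⟨c, hc, rfl⟩, h2⟩
    refine ⟨c.2, h2, fun x y z => ?_⟩
    rw [mem_twoCocycle_iff] at hc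
    have := DFunLike.congr_fun (DFunLike.congr_fun (DFunLike.congr_fun hc x) y) z
    rw [d₂₃_apply, hab, hab, hab, map_zero] at this
    simpa using this

/-- `coboundaries₂` consists of Mathlib's coboundaries of 1-cochains with values in `𝔤₁`. -/
theorem mem_coboundaries₂_iff {G : Grading L} (φ : G.gm1 →ₗ[ℝ] G.gm1 →ₗ[ℝ] L) :
    φ ∈ coboundaries₂ G ↔ ∃ f : oneCochain ℝ G.gm1 L,
      (∀ x, f x ∈ G.g1) ∧ (d₁₂ ℝ G.gm1 L f).1 = φ := by
  have hab : ∀ x y : G.gm1, ⁅x, y⁆ = 0 := fun x y => Subtype.ext (G.gm1_abelian x.2 y.2)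
  constructor
  · rintro ⟨f, hf, h⟩
    refine ⟨f, hf, ?_⟩
    ext x y
    rw [h]
    change ⁅x.1, f y⁆ - ⁅y.1, f x⁆ - f ⁅x, y⁆ = _
    rw [hab, map_zero, sub_zero]
  · rintro ⟨f, hf, rfl⟩
    refine ⟨f, hf, fun x y => ?_⟩
    change ⁅x.1, f y⁆ - ⁅y.1, f x⁆ - f ⁅x, y⁆ = _
    rw [hab, map_zero, sub_zero]

/-- The `𝔤₀`-module `H²₂`: the homogeneity `2` part of `H²(𝔤₋₁, 𝔤)`. -/
abbrev H₂₂ (G : Grading L) : Type :=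
  (cocycles₂ G) ⧸ ((coboundaries₂ G).comap (cocycles₂ G).incl)

/-- The annihilator in `𝔤₀` of an element of `H²₂`. -/
def ann (G : Grading L) (w : H₂₂ G) : LieSubalgebra ℝ G.g0 where
  carrier := {A | ⁅A, w⁆ = 0}
  add_mem' {A B} hA hB := by
    simp only [Set.mem_ofPred_eq] at *
    rw [add_lie, hA, hB, add_zero]
  zero_mem' := zero_lie w
  smul_mem' t A hA := by
    simp only [Set.mem_ofPred_eq] at *
    rw [smul_lie, hA, smul_zero]
  lie_mem' {A B} hA hB := by
    simp only [Set.mem_ofPred_eq] at *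
    rw [lie_lie, hA, hB, lie_zero, lie_zero, sub_zero]

/-- The graded Lie algebra `𝔤₋₁ ⊕ 𝔞`, for a subalgebra `𝔞` of `𝔤₀`. -/
def gradedSum (G : Grading L) (a : LieSubalgebra ℝ G.g0) : LieSubalgebra ℝ L where
  carrier := {X | ∃ v ∈ G.gm1, ∃ A ∈ a, X = v + A.1}
  add_mem' := by
    rintro _ _ ⟨v, hv, A, hA, rfl⟩ ⟨v', hv', A', hA', rfl⟩
    exact ⟨v + v', add_mem hv hv', A + A', add_mem hA hA', by
      rw [show (A + A').1 = A.1 + A'.1 from rfl]; abel⟩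
  zero_mem' := ⟨0, zero_mem _, 0, zero_mem _, by simp⟩
  smul_mem' := by
    rintro t _ ⟨v, hv, A, hA, rfl⟩
    exact ⟨t • v, G.gm1.smul_mem t hv, t • A, a.smul_mem t hA, by
      rw [smul_add]; rfl⟩
  lie_mem' := by
    rintro _ _ ⟨v, hv, A, hA, rfl⟩ ⟨v', hv', A', hA', rfl⟩
    refine ⟨⁅A.1, v'⁆ - ⁅A'.1, v⁆, sub_mem (G.lie_gm1 A.2 hv') (G.lie_gm1 A'.2 hv),
      ⁅A, A'⁆, a.lie_mem hA hA', ?_⟩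
    rw [add_lie, lie_add, lie_add, G.gm1_abelian hv hv', LieSubalgebra.coe_bracket,
      ← lie_skew v A'.1]
    abel

end Cohomology



attribute [local instance] LieRing.ofAssociativeRing

/-! ### The graded Lie algebra `𝔤 = 𝔰𝔩(n+1, ℍ) = 𝔤₋₁ ⊕ 𝔤₀ ⊕ 𝔤₁` -/

theorem re_trace_mul_comm {m : ℕ} (X Y : Matrix (Fin m) (Fin m) ℍ[ℝ]) :
    (X * Y).trace.re = (Y * X).trace.re := by
  have hre : ∀ f : Fin m → ℍ[ℝ], (∑ i, f i).re = ∑ i, (f i).re := fun f =>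
    map_sum (⟨⟨fun q : ℍ[ℝ] => q.re, rfl⟩, fun _ _ => rfl⟩ : ℍ[ℝ] →+ ℝ) f Finset.univ
  simp only [Matrix.trace, Matrix.diag, Matrix.mul_apply, hre]
  rw [Finset.sum_comm]
  refine Finset.sum_congr rfl fun i _ => Finset.sum_congr rfl fun j _ => ?_
  simp only [Quaternion.re_mul]
  ring

/-- `𝔰𝔩(m, ℍ)`: the quaternionic matrices whose trace has vanishing real part. -/
def sl (m : ℕ) : LieSubalgebra ℝ (Matrix (Fin m) (Fin m) ℍ[ℝ]) where
  carrier := {X | X.trace.re = 0}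
  add_mem' {X Y} hX hY := by
    simp only [Set.mem_ofPred_eq] at *
    simp [Matrix.trace_add, hX, hY]
  zero_mem' := by simp
  smul_mem' c X hX := by
    simp only [Set.mem_ofPred_eq] at *
    simp [Matrix.trace_smul, hX]
  lie_mem' {X Y} _ _ := by
    simp only [Set.mem_ofPred_eq, LieRing.of_associative_ring_bracket, Matrix.trace_sub,
      Quaternion.re_sub]
    exact sub_eq_zero.2 (re_trace_mul_comm X Y)

/-- `𝔤 = 𝔰𝔩(n+1, ℍ)`. An element is thought of as a block matrix `(a p; v A)`, with `a` the
entry at `(0,0)` and `A` an `n × n` block. -/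
abbrev g (n : ℕ) : LieSubalgebra ℝ (Matrix (Fin (n + 1)) (Fin (n + 1)) ℍ[ℝ]) := sl (n + 1)

theorem lie_entry {n : ℕ} (X Y : g n) (i j : Fin (n + 1)) :
    (⁅X, Y⁆ : g n).1 i j = ∑ k, X.1 i k * Y.1 k j - ∑ k, Y.1 i k * X.1 k j := by
  simp [LieSubalgebra.coe_bracket, LieRing.of_associative_ring_bracket, Matrix.mul_apply]

/-- `𝔤₋₁ ≅ ℍⁿ`: only the block `v` is nonzero. -/
def gm1 (n : ℕ) : LieSubalgebra ℝ (g n) where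
  carrier := {X | ∀ i j, ¬(i ≠ 0 ∧ j = 0) → X.1 i j = 0}
  add_mem' {X Y} hX hY i j h := by simp [hX i j h, hY i j h]
  zero_mem' i j _ := by simp
  smul_mem' c X hX i j h := by simp [hX i j h]
  lie_mem' {X Y} hX hY i j h := by
    rw [lie_entry, Finset.sum_eq_zero, Finset.sum_eq_zero, sub_zero]
    · intro k _
      by_cases hk : k = 0
      · rw [hX k j (fun h => h.1 hk), mul_zero]
      · rw [hY i k (fun h => hk h.2), zero_mul]
    · intro k _
      by_cases hk : k = 0
      · rw [hY k j (fun h => h.1 hk), mul_zero]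
      · rw [hX i k (fun h => hk h.2), zero_mul]

/-- `𝔤₀`: only the blocks `a` and `A` are nonzero. -/
def g0 (n : ℕ) : LieSubalgebra ℝ (g n) where
  carrier := {X | ∀ i j, ¬(i = 0 ↔ j = 0) → X.1 i j = 0}
  add_mem' {X Y} hX hY i j h := by simp [hX i j h, hY i j h]
  zero_mem' i j _ := by simp
  smul_mem' c X hX i j h := by simp [hX i j h]
  lie_mem' {X Y} hX hY i j h := by
    have key : ∀ U V : g n, (∀ i j, ¬(i = 0 ↔ j = 0) → U.1 i j = 0) →
        (∀ i j, ¬(i = 0 ↔ j = 0) → V.1 i j = 0) → ∑ k, U.1 i k * V.1 k j = 0 := by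
      intro U V hU hV
      refine Finset.sum_eq_zero fun k _ => ?_
      by_cases hk : (i = 0 ↔ k = 0)
      · rw [hV k j (fun h' => h (hk.trans h')), mul_zero]
      · rw [hU i k hk, zero_mul]
    rw [lie_entry, key X Y hX hY, key Y X hY hX, sub_zero]

/-- `𝔤₁ ≅ ℍⁿ*`: only the block `p` is nonzero. -/
def g1 (n : ℕ) : Submodule ℝ (g n) where
  carrier := {X | ∀ i j, ¬(i = 0 ∧ j ≠ 0) → X.1 i j = 0}
  add_mem' {X Y} hX hY i j h := by simp [hX i j h, hY i j h]
  zero_mem' i j _ := by simp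
  smul_mem' c X hX i j h := by simp [hX i j h]

theorem lie_mem_gm1 {n : ℕ} {A v : g n} (hA : A ∈ g0 n) (hv : v ∈ gm1 n) : ⁅A, v⁆ ∈ gm1 n := by
  intro i j h
  rw [lie_entry, Finset.sum_eq_zero, Finset.sum_eq_zero, sub_zero]
  · intro k _
    by_cases hk : i ≠ 0 ∧ k = 0
    · rw [hA k j (fun h' => h ⟨hk.1, h'.1 hk.2⟩), mul_zero]
    · rw [hv i k hk, zero_mul]
  · intro k _
    by_cases hk : k ≠ 0 ∧ j = 0
    · rw [hA i k (fun h' => h ⟨fun hi => hk.1 (h'.1 hi), hk.2⟩), zero_mul]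
    · rw [hv k j hk, mul_zero]

theorem lie_mem_g1 {n : ℕ} {A p : g n} (hA : A ∈ g0 n) (hp : p ∈ g1 n) : ⁅A, p⁆ ∈ g1 n := by
  intro i j h
  rw [lie_entry, Finset.sum_eq_zero, Finset.sum_eq_zero, sub_zero]
  · intro k _
    by_cases hk : i = 0 ∧ k ≠ 0
    · rw [hA k j (fun h' => h ⟨hk.1, fun hj => hk.2 (h'.2 hj)⟩), mul_zero]
    · rw [hp i k hk, zero_mul]
  · intro k _
    by_cases hk : k = 0 ∧ j ≠ 0
    · rw [hA i k (fun h' => h ⟨h'.2 hk.1, hk.2⟩), zero_mul]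
    · rw [hp k j hk, mul_zero]

theorem gm1_abelian {n : ℕ} {v w : g n} (hv : v ∈ gm1 n) (hw : w ∈ gm1 n) : ⁅v, w⁆ = 0 := by
  apply Subtype.ext
  ext1 i j
  rw [lie_entry, Finset.sum_eq_zero, Finset.sum_eq_zero, sub_zero]
  · rfl
  · intro k _
    by_cases hk : k = 0
    · rw [hv k j (fun h => h.1 hk), mul_zero]
    · rw [hw i k (fun h => hk h.2), zero_mul]
  · intro k _
    by_cases hk : k = 0
    · rw [hw k j (fun h => h.1 hk), mul_zero]
    · rw [hv i k (fun h => hk h.2), zero_mul]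

/-- The grading `𝔤₋₁ ⊕ 𝔤₀ ⊕ 𝔤₁` of `𝔰𝔩(n+1, ℍ)`. -/
@[reducible] def grading (n : ℕ) : Grading (g n) where
  gm1 := gm1 n
  g0 := g0 n
  g1 := g1 n
  gm1_abelian := gm1_abelian
  lie_gm1 := lie_mem_gm1
  lie_g1 := lie_mem_g1

/-- The curvature module `H²₂`, the homogeneity `2` part of `H²(𝔤₋₁, 𝔤)`. -/
abbrev CurvatureModule (n : ℕ) : Type := H₂₂ (grading n)

/-! ### Subalgebras and grading elements -/

/-- The block `A` of an element `(a 0; 0 A)` of `𝔤₀`. -/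
def block {n : ℕ} (X : g0 n) : Matrix (Fin n) (Fin n) ℍ[ℝ] := X.1.1.submatrix Fin.succ Fin.succ

/-- The diagonal element of `𝔤₀` with given real entries. -/
def diagElt (n : ℕ) (d : Fin (n + 1) → ℝ) (hd : ∑ i, d i = 0) : g0 n :=
  ⟨⟨Matrix.diagonal fun i => (d i : ℍ[ℝ]), by
    show (Matrix.trace (Matrix.diagonal fun i => (d i : ℍ[ℝ]))).re = 0
    rw [Matrix.trace_diagonal]
    have : (∑ i, (d i : ℍ[ℝ])) = ((∑ i, d i : ℝ) : ℍ[ℝ]) :=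
      (map_sum (algebraMap ℝ ℍ[ℝ]) d Finset.univ).symm
    rw [this, hd]; simp⟩, by
    intro i j h
    exact Matrix.diagonal_apply_ne _ (fun hij => h (by rw [hij]))⟩

/-- The grading element `Z = diag(n/(n+1), -1/(n+1), …, -1/(n+1))` of `𝔤`. -/
def gradZ (n : ℕ) : g0 n :=
  diagElt n (fun i => if i = 0 then (n : ℝ) / (n + 1) else -1 / (n + 1)) (by
    rw [Fin.sum_univ_succ]
    simp [Fin.succ_ne_zero]
    ring)

/-- The grading element `Z'` of `𝔰𝔩(n, ℍ)`, `n ≥ 2`, for the parabolic subalgebra whose nilradical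
is `𝔥₊` (see `heis`): `diag(1, 0, …, 0, -1)` for `n > 2` and `diag(1/2, -1/2)` for `n = 2`. -/
def gradZ' (n : ℕ) (hn : 2 ≤ n) : g0 n :=
  diagElt n (fun i => (if n = 2 then 1 / 2 else 1) *
      ((if i = ⟨1, by omega⟩ then 1 else 0) - (if i = Fin.last n then 1 else 0))) (by
    rw [← Finset.mul_sum, Finset.sum_sub_distrib]
    simp)

/-- `w` lies in the eigenspace of `Z'` for the largest eigenvalue `θ_max` of `Z'` on the
curvature module. -/
def IsExtremal (n : ℕ) (hn : 2 ≤ n) (w : CurvatureModule n) : Prop :=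
  ∃ θ : ℝ, IsGreatest
      {μ : ℝ | (LieModule.toEnd ℝ (g0 n) (CurvatureModule n) (gradZ' n hn)).HasEigenvalue μ} θ ∧
    ⁅gradZ' n hn, w⁆ = θ • w

/-- `w` is a nonzero extremal element, and its annihilator in `𝔤₀` has the largest dimension among
the annihilators of nonzero extremal elements. -/
def HasLargestAnn (n : ℕ) (hn : 2 ≤ n) (w : CurvatureModule n) : Prop :=
  IsExtremal n hn w ∧ w ≠ 0 ∧ ∀ w', IsExtremal n hn w' → w' ≠ 0 →
    Module.finrank ℝ (ann (grading n) w') ≤ Module.finrank ℝ (ann (grading n) w)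

/-- `𝔥𝔢𝔦𝔰(8n-12, ℍ)`, the quaternionification of the real Heisenberg algebra: the `n × n`
quaternionic matrices vanishing outside the first row and the last column, and on the diagonal. -/
def heis (n : ℕ) : LieSubalgebra ℝ (Matrix (Fin n) (Fin n) ℍ[ℝ]) where
  carrier := {X | ∀ i j, ¬((i.val = 0 ∨ j.val + 1 = n) ∧ i ≠ j) → X i j = 0}
  add_mem' {X Y} hX hY i j h := by simp [hX i j h, hY i j h]
  zero_mem' i j _ := by simp
  smul_mem' c X hX i j h := by simp [hX i j h]
  lie_mem' {X Y} hX hY i j h := by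
    have key : ∀ U V : Matrix (Fin n) (Fin n) ℍ[ℝ],
        (∀ i j, ¬((i.val = 0 ∨ j.val + 1 = n) ∧ i ≠ j) → U i j = 0) →
        (∀ i j, ¬((i.val = 0 ∨ j.val + 1 = n) ∧ i ≠ j) → V i j = 0) → (U * V) i j = 0 := by
      intro U V hU hV
      rw [Matrix.mul_apply]
      refine Finset.sum_eq_zero fun k _ => ?_
      by_cases h1 : (i.val = 0 ∨ k.val + 1 = n) ∧ i ≠ k
      · rw [hV k j, mul_zero]
        rw [ne_eq, Fin.ext_iff] at h h1 ⊢
        omega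
      · rw [hU i k h1, zero_mul]
    rw [LieRing.of_associative_ring_bracket, Matrix.sub_apply, key X Y hX hY, key Y X hY hX,
      sub_zero]

/-- `𝔥₊`: the copy of `𝔥𝔢𝔦𝔰(8n-12, ℍ)` in the block `𝔰𝔩(n, ℍ)` of `𝔤₀`. -/
def hplus (n : ℕ) : Submodule ℝ (g0 n) where
  carrier := {X | X.1.1 0 0 = 0 ∧ block X ∈ heis n}
  add_mem' {X Y} hX hY := ⟨by simp [hX.1, hY.1], add_mem hX.2 hY.2⟩
  zero_mem' := ⟨by simp, zero_mem (heis n)⟩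
  smul_mem' c X hX := ⟨by simp [hX.1], (heis n).smul_mem c hX.2⟩

/-- The `𝔤₀` matrices that vanish except for the diagonal entry `k`, which then has real part `0`:
a copy of `𝔰𝔭(1)`. -/
def spAt (n : ℕ) (k : Fin (n + 1)) : Submodule ℝ (g0 n) where
  carrier := {X | ∀ i j, ¬(i = k ∧ j = k) → X.1.1 i j = 0}
  add_mem' {X Y} hX hY i j h := by simp [hX i j h, hY i j h]
  zero_mem' i j _ := by simp
  smul_mem' c X hX i j h := by simp [hX i j h]

/-- The summand `𝔰𝔭(1)` of `𝔤₀ = 𝔰𝔭(1) ⊕ ℝZ ⊕ 𝔰𝔩(n, ℍ)`. -/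
def sp1 (n : ℕ) : Submodule ℝ (g0 n) := spAt n 0

/-- `𝔰𝔭(1)_left`, in the first diagonal entry of `𝔰𝔩(n, ℍ)`. -/
def sp1Left (n : ℕ) (hn : 2 ≤ n) : Submodule ℝ (g0 n) := spAt n ⟨1, by omega⟩

/-- `𝔰𝔭(1)_right`, in the last diagonal entry of `𝔰𝔩(n, ℍ)`. -/
def sp1Right (n : ℕ) : Submodule ℝ (g0 n) := spAt n (Fin.last n)

/-- `𝔤𝔩(m, ℍ)`, all quaternionic `m × m` matrices. -/
abbrev gl (m : ℕ) : Type := Matrix (Fin m) (Fin m) ℍ[ℝ]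

/-- The middle `(n-2) × (n-2)` block of the block `A` of an element of `𝔤₀`. -/
def midBlock {n : ℕ} (X : g0 n) : gl (n - 2) :=
  X.1.1.submatrix (fun i => ⟨i.val + 2, by omega⟩) (fun i => ⟨i.val + 2, by omega⟩)

/-- The subalgebra `𝔞` of `𝔤₀` is
`𝔰𝔭(1) ⊕ (𝔰𝔬(2) ⊕ ℝ ⊕ 𝔤𝔩(n-2, ℍ)) ⋉ 𝔥𝔢𝔦𝔰(8n-12, ℍ)`, as an internal semidirect sum: -/
structure HasCurvatureShape (n : ℕ) (hn : 2 ≤ n) (a k : LieSubalgebra ℝ (g0 n))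
    (r : Submodule ℝ (g0 n)) (e : gl (n - 2) →ₗ⁅ℝ⁆ g0 n) : Prop where
  /-- `𝔨` is a copy of `𝔰𝔬(2)` in `𝔰𝔭(1)_left ⊕ 𝔰𝔭(1)_right` -/
  so2 : k.toSubmodule ≤ sp1Left n hn ⊔ sp1Right n
  so2_equiv : Nonempty (k ≃ₗ⁅ℝ⁆ LieAlgebra.Orthogonal.so (Fin 2) ℝ)
  /-- `ℝ` is spanned by a linear combination of the grading elements `Z` and `Z'` -/
  line : ∃ s t : ℝ, s • gradZ n + t • gradZ' n hn ≠ 0 ∧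
    r = Submodule.span ℝ {s • gradZ n + t • gradZ' n hn}
  /-- `e` embeds `𝔤𝔩(n-2, ℍ)`, with the middle block of `e B` being `B` -/
  gl_block : ∀ B, midBlock (e B) = B
  /-- the sum of the five pieces is direct and equal to `𝔞` -/
  indep : iSupIndep ![sp1 n, k.toSubmodule, r, e.range.toSubmodule, hplus n]
  sup_eq : ⨆ i, (![sp1 n, k.toSubmodule, r, e.range.toSubmodule, hplus n]) i = a.toSubmodule
  /-- `𝔰𝔭(1)` is a direct summand -/
  sp1_comm : ∀ x ∈ sp1 n, ∀ y ∈ k.toSubmodule ⊔ r ⊔ e.range.toSubmodule ⊔ hplus n, ⁅x, y⁆ = 0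
  /-- the three pieces `𝔰𝔬(2)`, `ℝ`, `𝔤𝔩(n-2, ℍ)` commute with each other -/
  so2_line : ∀ x ∈ k, ∀ y ∈ r, ⁅x, y⁆ = 0
  so2_gl : ∀ x ∈ k, ∀ B, ⁅x, e B⁆ = 0
  line_gl : ∀ x ∈ r, ∀ B, ⁅x, e B⁆ = 0
  /-- `𝔥₊` is an ideal of `𝔞` -/
  ideal : ∀ x ∈ a, ∀ y ∈ hplus n, ⁅x, y⁆ ∈ hplus n

end AlmostQuaternionic

end

/-!
The theorem rests on the weights of `Z'`. Write `s` for the positive diagonal entry of `Z'`. On a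
matrix entry `(i, j)` of the value of a 2-cochain at two coordinate vectors with indices `k, l`, the
element `Z'` acts by `dᵢ - dⱼ - dₖ - dₗ`, where `d` is its diagonal. This number is at most `4s`,
with equality only for `i = 1` and `j = k = l = n` (`eq_topCochain_of_lie_eq`), and coboundaries
have no component of this weight. Since `Z' - μ` is injective, hence bijective, on coboundaries for
`μ ≥ 4s`, eigenvectors in the cohomology lift to eigenvectors among the cocycles
(`exists_eigenvector_lift`). So `θ_max = 4s`, and the extremal elements are the cocycles
`(x, y) ↦ ψ(xₙ, yₙ) E₁ₙ`; no further knowledge of the cohomology is needed.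

The cocycle condition becomes `ψ(y, z) x - ψ(x, z) y + ψ(x, y) z = 0` for alternating real bilinear
maps `ψ : ℍ × ℍ → ℍ`. Its solutions are `ψ(x, y) = α(y x̄)` for the real linear maps `α` with
`α(1) = 0` and `α(i) i + α(j) j + α(k) k = 0` (`exists_eq_weylForm`); in particular they are
invariant under right multiplication by unit quaternions, that is, under the summand `𝔰𝔭(1)`.

An element `X` of `𝔤₀` that annihilates the class of `α ≠ 0` has no entries of negative `Z'`-weight:
otherwise its bracket with a suitable element of `𝔥₊`, which also annihilates the class, would have
diagonal entries that act by a nonzero scalar (`inParabolic_of_mem_ann`). What remains is a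
condition on three diagonal entries (`mem_ann_iff`), which splits into a real linear equation and a
condition on imaginary parts because imaginary quaternions act by skew-symmetric maps
(`stab_iff_im`). This gives the five summands, the only part that depends on `α` being the
stabilizer `𝔨` in `𝔰𝔭(1)_left ⊕ 𝔰𝔭(1)_right` (`finrank_ann`, `hasCurvatureShape`).

The projection of `𝔨` to the right factor is injective. If `dim 𝔨 ≥ 2`, then closure under the
bracket makes it surjective, and evaluating the condition at `i, j, k` forces `α = 0`
(`not_stab_three`). Hence `dim 𝔨 ≤ 1`, with equality for `α(i) = 0`, `α(j) = 1`, `α(k) = i`, which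
is annihilated by `(3i, i)`. So the annihilators of largest dimension are those with `dim 𝔨 = 1`.
-/

open scoped Quaternion

noncomputable section

namespace AlmostQuaternionic

attribute [local instance] LieRing.ofAssociativeRing

/-! ### Lifting eigenvectors along a quotient of Lie modules -/

/-- If `X - μ` is injective on a finite-dimensional submodule `N`, it is bijective there, so an
eigenvector of `X` in the quotient by `N` can be corrected to an eigenvector upstairs. -/
theorem exists_eigenvector_lift {L M : Type*} [LieRing L] [LieAlgebra ℝ L] [AddCommGroup M]
    [Module ℝ M] [LieRingModule L M] [LieModule ℝ L M] [Module.Finite ℝ M]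
    (N : LieSubmodule ℝ L M) (X : L) (μ : ℝ) (hN : ∀ m ∈ N, ⁅X, m⁆ = μ • m → m = 0)
    (w : M ⧸ N) (hw : ⁅X, w⁆ = μ • w) :
    ∃ m : M, ⁅X, m⁆ = μ • m ∧ LieSubmodule.Quotient.mk' N m = w := by
  obtain ⟨m, rfl⟩ := LieSubmodule.Quotient.surjective_mk' N w
  let f : N →ₗ[ℝ] N := LieModule.toEnd ℝ L N X - μ • LinearMap.id
  have hf : ∀ u : N, (f u).1 = ⁅X, u.1⁆ - μ • u.1 := fun u => rfl
  have hinj : Function.Injective f := by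
    refine (injective_iff_map_eq_zero f).2 fun u hu => Subtype.ext (hN u.1 u.2 ?_)
    have := hf u
    rw [hu] at this
    exact sub_eq_zero.1 this.symm
  have hfin : Module.Finite ℝ N := inferInstanceAs (Module.Finite ℝ N.toSubmodule)
  have hsurj : Function.Surjective f := LinearMap.injective_iff_surjective.1 hinj
  have hmem : ⁅X, m⁆ - μ • m ∈ N := by
    rw [← LieSubmodule.Quotient.mk_eq_zero, map_sub, map_smul, LieModuleHom.map_lie, hw, sub_self]
  obtain ⟨u, hu⟩ := hsurj ⟨_, hmem⟩
  have h1 : ⁅X, u.1⁆ - μ • u.1 = ⁅X, m⁆ - μ • m := by rw [← hf, hu]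
  refine ⟨m - u.1, ?_, ?_⟩
  · rw [lie_sub, smul_sub, sub_eq_sub_iff_sub_eq_sub, ← sub_eq_zero]
    rw [sub_eq_iff_eq_add] at h1
    rw [h1]
    abel
  · rw [map_sub, sub_eq_self]
    exact (LieSubmodule.Quotient.mk_eq_zero N).2 u.2

/-! ### Matrix entries of brackets and cochains -/

/-- The index of the first row of the block `A`. -/
def one (n : ℕ) (hn : 2 ≤ n) : Fin (n + 1) := ⟨1, by omega⟩

theorem one_ne_zero' {n : ℕ} (hn : 2 ≤ n) : one n hn ≠ 0 := by
  simp [one, Fin.ext_iff]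

theorem last_ne_zero' {n : ℕ} (hn : 2 ≤ n) : Fin.last n ≠ 0 := by
  simp only [ne_eq, Fin.ext_iff, Fin.val_last, Fin.val_zero]
  omega

theorem one_ne_last {n : ℕ} (hn : 2 ≤ n) : one n hn ≠ Fin.last n := by
  simp only [one, ne_eq, Fin.ext_iff, Fin.val_last]
  omega

/-- The action of `𝔤₀` on `𝔤₋₁`, restated because instance search unfolds `grading n`. -/
instance (n : ℕ) : LieRingModule (g0 n) (gm1 n) :=
  instLieRingModuleSubtypeMemLieSubalgebraRealG0Gm1 (grading n)

instance (n : ℕ) : LieModule ℝ (g0 n) (gm1 n) :=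
  instLieModuleRealSubtypeMemLieSubalgebraG0Gm1 (grading n)

theorem coe_lie_gm1 {n : ℕ} (X : (grading n).g0) (v : (grading n).gm1) :
    ⁅X, v⁆.1 = ⁅X.1, v.1⁆ := rfl

theorem lie_cochain_grading_apply {n : ℕ} (X : (grading n).g0)
    (φ : (grading n).gm1 →ₗ[ℝ] (grading n).gm1 →ₗ[ℝ] g n) (x y : (grading n).gm1) :
    ⁅X, φ⁆ x y = ⁅X.1, φ x y⁆ - φ x ⁅X, y⁆ - φ ⁅X, x⁆ y := lie_cochain_apply X φ x y

/-- The entry `(i, j)` of an element of `𝔤`, as a linear form. -/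
def ent {n : ℕ} (i j : Fin (n + 1)) : g n →ₗ[ℝ] ℍ[ℝ] where
  toFun X := X.1 i j
  map_add' _ _ := rfl
  map_smul' _ _ := rfl

theorem ext_ent {n : ℕ} {X Y : g n} (h : ∀ i j, ent i j X = ent i j Y) : X = Y :=
  Subtype.ext (by ext1 i j; exact h i j)

theorem ent_lie {n : ℕ} (X Y : g n) (i j : Fin (n + 1)) :
    ent i j ⁅X, Y⁆ = ∑ k, ent i k X * ent k j Y - ∑ k, ent i k Y * ent k j X :=
  lie_entry X Y i j

theorem ent_gm1 {n : ℕ} {X : g n} (hX : X ∈ gm1 n) {i j : Fin (n + 1)} (h : ¬(i ≠ 0 ∧ j = 0)) :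
    ent i j X = 0 := hX i j h

theorem ent_g0 {n : ℕ} {X : g n} (hX : X ∈ g0 n) {i j : Fin (n + 1)} (h : ¬(i = 0 ↔ j = 0)) :
    ent i j X = 0 := hX i j h

theorem ent_g1 {n : ℕ} {X : g n} (hX : X ∈ g1 n) {i j : Fin (n + 1)} (h : ¬(i = 0 ∧ j ≠ 0)) :
    ent i j X = 0 := hX i j h

/-- The element of `𝔤` with single nonzero entry `q` at `(i, j)`, for `i ≠ j`. -/
def offDiag {n : ℕ} (i j : Fin (n + 1)) (h : i ≠ j) : ℍ[ℝ] →ₗ[ℝ] g n where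
  toFun q := ⟨Matrix.single i j q, by
    show (Matrix.trace (Matrix.single i j q)).re = 0
    rw [Matrix.trace_single_eq_of_ne _ _ _ h]
    rfl⟩
  map_add' p q := Subtype.ext (Matrix.single_add i j p q)
  map_smul' c q := Subtype.ext (Matrix.smul_single c i j q).symm

@[simp] theorem ent_offDiag {n : ℕ} {i j : Fin (n + 1)} (h : i ≠ j) (q : ℍ[ℝ])
    (k l : Fin (n + 1)) : ent k l (offDiag i j h q) = if i = k ∧ j = l then q else 0 :=
  Matrix.single_apply i j q k l

theorem offDiag_mem_g0 {n : ℕ} {i j : Fin (n + 1)} (h : i ≠ j) (hi : i ≠ 0) (hj : j ≠ 0)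
    (q : ℍ[ℝ]) : offDiag i j h q ∈ g0 n := by
  intro k l hkl
  show ent k l (offDiag i j h q) = 0
  rw [ent_offDiag, if_neg]
  rintro ⟨rfl, rfl⟩
  exact hkl ⟨fun h => absurd h hi, fun h => absurd h hj⟩

/-- The vector of `𝔤₋₁` with single nonzero coordinate `q` at `k`. -/
def vec {n : ℕ} (k : Fin (n + 1)) (h : k ≠ 0) : ℍ[ℝ] →ₗ[ℝ] (grading n).gm1 where
  toFun q := ⟨offDiag k 0 h q, fun i j hij => by
    show ent i j (offDiag k 0 h q) = 0
    rw [ent_offDiag, if_neg]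
    rintro ⟨rfl, rfl⟩
    exact hij ⟨h, rfl⟩⟩
  map_add' p q := Subtype.ext (map_add _ _ _)
  map_smul' c q := Subtype.ext (map_smul _ _ _)

@[simp] theorem ent_vec {n : ℕ} {k : Fin (n + 1)} (h : k ≠ 0) (q : ℍ[ℝ])
    (i j : Fin (n + 1)) : ent i j (vec k h q).1 = if k = i ∧ 0 = j then q else 0 :=
  ent_offDiag h q i j

/-- The coordinate `k` of a vector of `𝔤₋₁`. -/
def coordAt {n : ℕ} (k : Fin (n + 1)) : (grading n).gm1 →ₗ[ℝ] ℍ[ℝ] :=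
  ent k 0 ∘ₗ (gm1 n).toSubmodule.subtype

theorem coordAt_apply {n : ℕ} (k : Fin (n + 1)) (v : (grading n).gm1) :
    coordAt k v = ent k 0 v.1 := rfl

theorem coordAt_vec {n : ℕ} {k : Fin (n + 1)} (h : k ≠ 0) (q : ℍ[ℝ]) (l : Fin (n + 1)) :
    coordAt l (vec k h q) = if k = l then q else 0 := by
  rw [coordAt_apply, ent_vec]
  simp

theorem eq_sum_vec {n : ℕ} (v : (grading n).gm1) :
    v = ∑ k : Fin n, vec k.succ (Fin.succ_ne_zero k) (coordAt k.succ v) := by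
  apply Subtype.ext
  refine ext_ent fun i j => ?_
  have hs : ∀ f : Fin n → (grading n).gm1, ent i j (∑ k, f k).1 = ∑ k, ent i j (f k).1 := fun f =>
    map_sum (ent i j ∘ₗ (gm1 n).toSubmodule.subtype) f Finset.univ
  rw [hs]
  have he : ∀ k : Fin n, ent i j (vec k.succ (Fin.succ_ne_zero k) (coordAt k.succ v)).1 =
      if k.succ = i ∧ 0 = j then coordAt k.succ v else 0 := fun k => ent_vec _ _ _ _
  rw [Finset.sum_congr rfl fun k _ => he k]
  by_cases hj : j = 0
  · subst hj
    refine Fin.cases ?_ (fun i => ?_) i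
    · rw [ent_gm1 v.2 (by simp)]
      simp [Fin.succ_ne_zero]
    · rw [Finset.sum_eq_single i, if_pos ⟨rfl, rfl⟩]
      · rfl
      · intro k _ hk
        rw [if_neg fun h => hk (Fin.succ_injective _ h.1)]
      · simp
  · rw [ent_gm1 v.2 (fun h => hj h.2), Finset.sum_eq_zero]
    intro k _
    rw [if_neg fun h => hj h.2.symm]

/-- A 2-cochain is determined by its values on coordinate vectors. -/
theorem cochain_ext {n : ℕ} {φ ψ : (grading n).gm1 →ₗ[ℝ] (grading n).gm1 →ₗ[ℝ] g n}
    (h : ∀ k l (hk : k ≠ 0) (hl : l ≠ 0) x y i j,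
      ent i j (φ (vec k hk x) (vec l hl y)) = ent i j (ψ (vec k hk x) (vec l hl y))) : φ = ψ := by
  ext1 x
  ext1 y
  rw [eq_sum_vec x, eq_sum_vec y]
  simp only [map_sum, LinearMap.sum_apply]
  exact Finset.sum_congr rfl fun k _ => Finset.sum_congr rfl fun l _ =>
    ext_ent fun i j => h _ _ _ _ _ _ i j

theorem ent_diagElt {n : ℕ} (d : Fin (n + 1) → ℝ) (hd : ∑ i, d i = 0) (i j : Fin (n + 1)) :
    ent i j (diagElt n d hd).1 = if i = j then (d i : ℍ[ℝ]) else 0 :=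
  Matrix.diagonal_apply _ i j

theorem ent_diagElt_lie {n : ℕ} (d : Fin (n + 1) → ℝ) (hd : ∑ i, d i = 0) (Y : g n)
    (i j : Fin (n + 1)) : ent i j ⁅(diagElt n d hd).1, Y⁆ = (d i - d j) • ent i j Y := by
  rw [ent_lie]
  simp only [ent_diagElt, ite_mul, mul_ite, zero_mul, mul_zero, Finset.sum_ite_eq,
    Finset.sum_ite_eq', Finset.mem_univ, if_true]
  rw [sub_smul, ← Quaternion.coe_mul_eq_smul, ← Quaternion.coe_mul_eq_smul,
    Quaternion.coe_commutes (d j)]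

theorem coordAt_lie {n : ℕ} (X : (grading n).g0) (v : (grading n).gm1) (k : Fin (n + 1)) :
    coordAt k ⁅X, v⁆ = ∑ l, ent k l X.1 * coordAt l v - coordAt k v * ent 0 0 X.1 := by
  rw [coordAt_apply, coe_lie_gm1, ent_lie]
  congr 1
  rw [Finset.sum_eq_single 0 _ (by simp)]
  · rfl
  · intro l _ hl
    rw [ent_gm1 v.2 (fun h => hl h.2), zero_mul]

theorem diagElt_lie_vec {n : ℕ} (d : Fin (n + 1) → ℝ) (hd : ∑ i, d i = 0) (X : (grading n).g0)
    (hX : X = diagElt n d hd) (k : Fin (n + 1)) (hk : k ≠ 0) (x : ℍ[ℝ]) :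
    ⁅X, vec k hk x⁆ = (d k - d 0) • vec k hk x := by
  apply Subtype.ext
  refine ext_ent fun i j => ?_
  rw [coe_lie_gm1, hX, ent_diagElt_lie]
  show _ = ent i j ((d k - d 0) • (vec k hk x).1)
  rw [map_smul, ent_vec]
  split_ifs with h
  · rw [← h.1, ← h.2]
  · simp

theorem ent_diagElt_lie_cochain {n : ℕ} (d : Fin (n + 1) → ℝ) (hd : ∑ i, d i = 0)
    (X : (grading n).g0) (hX : X = diagElt n d hd)
    (φ : (grading n).gm1 →ₗ[ℝ] (grading n).gm1 →ₗ[ℝ] g n) (k l : Fin (n + 1)) (hk : k ≠ 0)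
    (hl : l ≠ 0) (x y : ℍ[ℝ]) (i j : Fin (n + 1)) :
    ent i j (⁅X, φ⁆ (vec k hk x) (vec l hl y)) =
      (d i - d j - d k - d l + 2 * d 0) • ent i j (φ (vec k hk x) (vec l hl y)) := by
  rw [lie_cochain_grading_apply, diagElt_lie_vec d hd X hX, diagElt_lie_vec d hd X hX]
  simp only [map_smul, map_sub, LinearMap.smul_apply]
  rw [hX, ent_diagElt_lie]
  module

/-! ### The quaternionic model of the extremal elements -/

/-- The quaternion `i`. -/
def qi : ℍ[ℝ] := ⟨0, 1, 0, 0⟩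

/-- The quaternion `j`. -/
def qj : ℍ[ℝ] := ⟨0, 0, 1, 0⟩

/-- The quaternion `k`. -/
def qk : ℍ[ℝ] := ⟨0, 0, 0, 1⟩

@[simp] theorem qi_re : qi.re = 0 := rfl
@[simp] theorem qi_imI : qi.imI = 1 := rfl
@[simp] theorem qi_imJ : qi.imJ = 0 := rfl
@[simp] theorem qi_imK : qi.imK = 0 := rfl
@[simp] theorem qj_re : qj.re = 0 := rfl
@[simp] theorem qj_imI : qj.imI = 0 := rfl
@[simp] theorem qj_imJ : qj.imJ = 1 := rfl
@[simp] theorem qj_imK : qj.imK = 0 := rfl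
@[simp] theorem qk_re : qk.re = 0 := rfl
@[simp] theorem qk_imI : qk.imI = 0 := rfl
@[simp] theorem qk_imJ : qk.imJ = 0 := rfl
@[simp] theorem qk_imK : qk.imK = 1 := rfl

theorem eq_sum_basis (x : ℍ[ℝ]) :
    x = x.re • (1 : ℍ[ℝ]) + x.imI • qi + x.imJ • qj + x.imK • qk := by
  ext <;> simp

/-- The linear map `α` on quaternions that vanishes on `1` and has the values `P, Q, R` on
`i, j, k`. -/
def imMap (P Q R : ℍ[ℝ]) : ℍ[ℝ] →ₗ[ℝ] ℍ[ℝ] where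
  toFun u := u.imI • P + u.imJ • Q + u.imK • R
  map_add' u v := by simp only [Quaternion.imI_add, Quaternion.imJ_add, Quaternion.imK_add]; module
  map_smul' c u := by
    simp only [Quaternion.imI_smul, Quaternion.imJ_smul, Quaternion.imK_smul, RingHom.id_apply,
      smul_eq_mul]
    module

theorem imMap_apply (P Q R u : ℍ[ℝ]) :
    imMap P Q R u = u.imI • P + u.imJ • Q + u.imK • R := rfl

/-- The bilinear map `(x, y) ↦ α(y x̄)`. -/
def weylForm (P Q R : ℍ[ℝ]) : ℍ[ℝ] →ₗ[ℝ] ℍ[ℝ] →ₗ[ℝ] ℍ[ℝ] :=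
  LinearMap.mk₂ ℝ (fun x y => imMap P Q R (y * star x))
    (fun x x' y => by rw [star_add, mul_add, map_add])
    (fun c x y => by rw [Quaternion.star_smul, mul_smul_comm, map_smul])
    (fun x y y' => by rw [add_mul, map_add])
    (fun c x y => by rw [smul_mul_assoc, map_smul])

theorem weylForm_apply (P Q R x y : ℍ[ℝ]) :
    weylForm P Q R x y = imMap P Q R (y * star x) := rfl

/-- The solutions of the cocycle condition for alternating `ℝ`-bilinear maps `ℍ × ℍ → ℍ` form an
eight-dimensional space, parametrized by the `α` with `α(i) i + α(j) j + α(k) k = 0`. -/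
theorem exists_eq_weylForm (ψ : ℍ[ℝ] →ₗ[ℝ] ℍ[ℝ] →ₗ[ℝ] ℍ[ℝ]) (halt : ∀ x, ψ x x = 0)
    (hcyc : ∀ x y z, ψ y z * x - ψ x z * y + ψ x y * z = 0) :
    ∃ P Q R, P * qi + Q * qj + R * qk = 0 ∧ ψ = weylForm P Q R := by
  have hsk : ∀ x y, ψ x y = -ψ y x := fun x y => by
    have := halt (x + y)
    rw [map_add, map_add, LinearMap.add_apply, LinearMap.add_apply, halt, halt, zero_add,
      add_zero] at this
    exact eq_neg_of_add_eq_zero_right this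
  have h1 := hcyc 1 qi qj
  have h2 := hcyc 1 qi qk
  have h3 := hcyc 1 qj qk
  have h4 := hcyc qi qj qk
  rw [mul_one] at h1 h2 h3
  have e1 : ψ qi qj = ψ 1 qj * qi - ψ 1 qi * qj := by rw [← sub_eq_zero, ← h1]; abel
  have e2 : ψ qi qk = ψ 1 qk * qi - ψ 1 qi * qk := by rw [← sub_eq_zero, ← h2]; abel
  have e3 : ψ qj qk = ψ 1 qk * qj - ψ 1 qj * qk := by rw [← sub_eq_zero, ← h3]; abel
  rw [e1, e2, e3] at h4
  have h5 : ψ 1 qi * qi + ψ 1 qj * qj + ψ 1 qk * qk = 0 := by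
    have := h4
    rw [Quaternion.ext_iff] at this ⊢
    simp at this ⊢
    refine ⟨?_, ?_, ?_, ?_⟩ <;> linarith
  have e1' : ψ qi qj = ψ 1 qk := by
    rw [e1]
    rw [Quaternion.ext_iff] at h5 ⊢
    simp at h5 ⊢
    refine ⟨?_, ?_, ?_, ?_⟩ <;> linarith
  have e2' : ψ qi qk = -ψ 1 qj := by
    rw [e2]
    rw [Quaternion.ext_iff] at h5 ⊢
    simp at h5 ⊢
    refine ⟨?_, ?_, ?_, ?_⟩ <;> linarith
  have e3' : ψ qj qk = ψ 1 qi := by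
    rw [e3]
    rw [Quaternion.ext_iff] at h5 ⊢
    simp at h5 ⊢
    refine ⟨?_, ?_, ?_, ?_⟩ <;> linarith
  refine ⟨ψ 1 qi, ψ 1 qj, ψ 1 qk, h5, ?_⟩
  ext1 x
  ext1 y
  rw [weylForm_apply, imMap_apply]
  conv_lhs => rw [eq_sum_basis x, eq_sum_basis y]
  simp only [map_add, map_smul, LinearMap.add_apply, LinearMap.smul_apply, halt, hsk qi 1,
    hsk qj 1, hsk qk 1, hsk qj qi, hsk qk qi, hsk qk qj, e1', e2', e3']
  simp only [Quaternion.imI_mul, Quaternion.imJ_mul, Quaternion.imK_mul, Quaternion.re_star,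
    Quaternion.imI_star, Quaternion.imJ_star, Quaternion.imK_star]
  module

/-- The infinitesimal stabilizer condition: diagonal entries `p`, `q` in the first and last row of
the block `A` and real part `r` of the entry `a` annihilate the extremal element given by `α`. -/
def Stab (P Q R p q : ℍ[ℝ]) (r : ℝ) : Prop :=
  ∀ v, p * imMap P Q R v - imMap P Q R v * q - imMap P Q R (v * star q + q * v)
    + (2 * r) • imMap P Q R v = 0

theorem stab_iff (P Q R p q : ℍ[ℝ]) (r : ℝ) : Stab P Q R p q r ↔
    p * P - P * q - ((2 * q.re) • P + (2 * q.imK) • Q - (2 * q.imJ) • R) + (2 * r) • P = 0 ∧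
    p * Q - Q * q - ((2 * q.re) • Q + (2 * q.imI) • R - (2 * q.imK) • P) + (2 * r) • Q = 0 ∧
    p * R - R * q - ((2 * q.re) • R + (2 * q.imJ) • P - (2 * q.imI) • Q) + (2 * r) • R = 0 := by
  have key : ∀ v, imMap P Q R (v * star q + q * v) =
      v.imI • ((2 * q.re) • P + (2 * q.imK) • Q - (2 * q.imJ) • R) +
      v.imJ • ((2 * q.re) • Q + (2 * q.imI) • R - (2 * q.imK) • P) +
      v.imK • ((2 * q.re) • R + (2 * q.imJ) • P - (2 * q.imI) • Q) := fun v => by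
    rw [imMap_apply]
    simp only [Quaternion.imI_add, Quaternion.imJ_add, Quaternion.imK_add, Quaternion.imI_mul,
      Quaternion.imJ_mul, Quaternion.imK_mul, Quaternion.re_star, Quaternion.imI_star,
      Quaternion.imJ_star, Quaternion.imK_star]
    module
  constructor
  · intro h
    refine ⟨?_, ?_, ?_⟩
    · have := h qi
      rw [key] at this
      simpa [imMap_apply] using this
    · have := h qj
      rw [key] at this
      simpa [imMap_apply] using this
    · have := h qk
      rw [key] at this
      simpa [imMap_apply] using this
  · rintro ⟨h1, h2, h3⟩ v
    rw [key, imMap_apply]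
    have := congrArg₂ (fun a b : ℍ[ℝ] => a + b) (congrArg (fun a : ℍ[ℝ] => v.imI • a) h1)
      (congrArg₂ (fun a b : ℍ[ℝ] => a + b) (congrArg (fun a : ℍ[ℝ] => v.imJ • a) h2)
        (congrArg (fun a : ℍ[ℝ] => v.imK • a) h3))
    simp only [smul_zero, add_zero] at this
    rw [← this]
    simp only [mul_add, add_mul, mul_smul_comm, smul_mul_assoc]
    module

theorem sq_norms_ne_zero {P Q R : ℍ[ℝ]} (h : ¬(P = 0 ∧ Q = 0 ∧ R = 0)) :
    Quaternion.normSq P + Quaternion.normSq Q + Quaternion.normSq R ≠ 0 := by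
  intro h0
  have hP := Quaternion.normSq_nonneg (a := P)
  have hQ := Quaternion.normSq_nonneg (a := Q)
  have hR := Quaternion.normSq_nonneg (a := R)
  exact h ⟨Quaternion.normSq_eq_zero.1 (by linarith), Quaternion.normSq_eq_zero.1 (by linarith),
    Quaternion.normSq_eq_zero.1 (by linarith)⟩

/-- The imaginary parts of `p` and `q` act by skew-symmetric maps, so pairing the stabilizer
equation with `α` isolates the scalar part. -/
theorem Stab.re_eq {P Q R p q : ℍ[ℝ]} {r : ℝ} (h : ¬(P = 0 ∧ Q = 0 ∧ R = 0))
    (hs : Stab P Q R p q r) : p.re - 3 * q.re + 2 * r = 0 := by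
  obtain ⟨h1, h2, h3⟩ := (stab_iff ..).1 hs
  refine (mul_eq_zero.1 (?_ : _ * (Quaternion.normSq P + Quaternion.normSq Q +
    Quaternion.normSq R) = 0)).resolve_right (sq_norms_ne_zero h)
  rw [Quaternion.ext_iff] at h1 h2 h3
  simp only [Quaternion.re_add, Quaternion.re_sub, Quaternion.re_mul, Quaternion.re_smul,
    Quaternion.imI_add, Quaternion.imI_sub, Quaternion.imI_mul, Quaternion.imI_smul,
    Quaternion.imJ_add, Quaternion.imJ_sub, Quaternion.imJ_mul, Quaternion.imJ_smul,
    Quaternion.imK_add, Quaternion.imK_sub, Quaternion.imK_mul, Quaternion.imK_smul,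
    Quaternion.re_zero, Quaternion.imI_zero, Quaternion.imJ_zero, Quaternion.imK_zero,
    smul_eq_mul] at h1 h2 h3
  obtain ⟨a1, a2, a3, a4⟩ := h1
  obtain ⟨b1, b2, b3, b4⟩ := h2
  obtain ⟨c1, c2, c3, c4⟩ := h3
  simp only [Quaternion.normSq_def']
  linear_combination P.re * a1 + P.imI * a2 + P.imJ * a3 + P.imK * a4 + Q.re * b1 + Q.imI * b2 +
    Q.imJ * b3 + Q.imK * b4 + R.re * c1 + R.imI * c2 + R.imJ * c3 + R.imK * c4

theorem stab_iff_im {P Q R p q : ℍ[ℝ]} {r : ℝ} (h : ¬(P = 0 ∧ Q = 0 ∧ R = 0)) :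
    Stab P Q R p q r ↔ p.re - 3 * q.re + 2 * r = 0 ∧ Stab P Q R p.im q.im 0 := by
  have key : p.re - 3 * q.re + 2 * r = 0 → (Stab P Q R p q r ↔ Stab P Q R p.im q.im 0) := by
    intro h0
    refine forall_congr' fun v => ?_
    have hr : 2 * r = 3 * q.re - p.re := by linarith
    have ep : p * imMap P Q R v = p.re • imMap P Q R v + p.im * imMap P Q R v := by
      rw [← Quaternion.coe_mul_eq_smul, ← add_mul, Quaternion.re_add_im]
    have eq : imMap P Q R v * q = q.re • imMap P Q R v + imMap P Q R v * q.im := by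
      rw [← Quaternion.mul_coe_eq_smul, ← mul_add, Quaternion.re_add_im]
    have e : v * star q + q * v = (2 * q.re) • v + (v * star q.im + q.im * v) := by
      ext <;> simp <;> ring
    rw [hr, ep, eq, e, map_add, map_smul]
    refine Eq.congr ?_ rfl
    module
  exact ⟨fun hs => ⟨hs.re_eq h, (key (hs.re_eq h)).1 hs⟩, fun hs => (key hs.1).2 hs.2⟩

theorem Stab.eq_zero {P Q R p : ℍ[ℝ]} (h : ¬(P = 0 ∧ Q = 0 ∧ R = 0))
    (hs : Stab P Q R p 0 0) : p = 0 := by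
  obtain ⟨h1, h2, h3⟩ := (stab_iff ..).1 hs
  simp at h1 h2 h3
  by_contra hp
  exact h ⟨h1.resolve_left hp, h2.resolve_left hp, h3.resolve_left hp⟩

/-- No copy of `𝔰𝔭(1)` that projects onto the right factor annihilates `α`: there are no invariants
in the tensor product of the irreducible representations of dimensions 2 and 4. -/
theorem not_stab_three {P Q R A B C : ℍ[ℝ]} (h : ¬(P = 0 ∧ Q = 0 ∧ R = 0))
    (h0 : P * qi + Q * qj + R * qk = 0) (hA : Stab P Q R A qi 0) (hB : Stab P Q R B qj 0)
    (hC : Stab P Q R C qk 0) : False := by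
  obtain ⟨a1, a2, a3⟩ := (stab_iff ..).1 hA
  obtain ⟨b1, b2, b3⟩ := (stab_iff ..).1 hB
  obtain ⟨c1, c2, c3⟩ := (stab_iff ..).1 hC
  simp only [qi_re, qi_imI, qi_imJ, qi_imK, qj_re, qj_imI, qj_imJ, qj_imK, qk_re, qk_imI, qk_imJ,
    qk_imK, mul_zero, mul_one, zero_smul, add_zero, sub_zero, zero_add, zero_sub] at *
  have ii : qi * qi = -1 := by ext <;> simp
  have jj : qj * qj = -1 := by ext <;> simp
  have kk : qk * qk = -1 := by ext <;> simp
  have two : ∀ x : ℍ[ℝ], (2 : ℝ) • x = x + x := two_smul ℝ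
  rw [two] at a2 a3 b1 b3 c1 c2
  -- If one of the three values vanishes, so do the other two.
  have dbl : ∀ x : ℍ[ℝ], x + x = 0 → x = 0 := fun x hx => by
    rw [← two] at hx
    exact (smul_eq_zero.1 hx).resolve_left two_ne_zero
  have dbl' : ∀ x : ℍ[ℝ], -x + -x = 0 → x = 0 := fun x hx => neg_eq_zero.1 (dbl _ hx)
  have hP : P ≠ 0 := by
    rintro rfl
    exact h ⟨rfl, dbl' _ (by simpa using c1), dbl _ (by simpa using b1)⟩
  have hQ : Q ≠ 0 := by
    rintro rfl
    exact h ⟨dbl _ (by simpa using c2), rfl, dbl' _ (by simpa using a2)⟩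
  have hR : R ≠ 0 := by
    rintro rfl
    exact h ⟨dbl' _ (by simpa using b3), dbl _ (by simpa using a3), rfl⟩
  -- The eigenvector equations `A P = P i` and the like force `A² = B² = C² = -1`.
  have sq : ∀ A P i : ℍ[ℝ], i * i = -1 → P ≠ 0 → A * P = P * i → A * A = -1 := by
    intro A P i hi hP hAP
    apply mul_right_cancel₀ hP
    rw [mul_assoc, hAP, ← mul_assoc, hAP, mul_assoc, hi, mul_neg_one, neg_one_mul]
  have hAA := sq A P qi ii hP (sub_eq_zero.1 a1)
  have hBB := sq B Q qj jj hQ (sub_eq_zero.1 b2)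
  have rel : ∀ A Q R i : ℍ[ℝ], i * i = -1 → A * A = -1 → A * Q - Q * i - (R + R) = 0 →
      A * R - R * i - -(Q + Q) = 0 → R * i = Q := by
    intro A Q R i hi hA h1 h2
    have e1 : A * Q = Q * i + (R + R) := by rw [← sub_eq_zero, ← h1]; abel
    have e2 : A * R = R * i - (Q + Q) := by rw [← sub_eq_zero, ← h2]; abel
    have e3 : A * (A * Q) = -Q := by rw [← mul_assoc, hA, neg_one_mul]
    rw [e1, mul_add, mul_add, e2, ← mul_assoc, e1, add_mul, add_mul, mul_assoc, hi,
      mul_neg_one] at e3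
    have e4 : (4 : ℝ) • (R * i - Q) = 0 := by
      have : (4 : ℝ) • (R * i - Q) =
        (-Q + (R * i + R * i) + (R * i - (Q + Q) + (R * i - (Q + Q)))) - -Q := by module
      rw [this, e3, sub_self]
    exact sub_eq_zero.1 ((smul_eq_zero.1 e4).resolve_left four_ne_zero)
  have r1 := rel A Q R qi ii hAA a2 a3
  have r2 := rel B R P qj jj hBB b3 b1
  have e : P * qi + P * qi + P * qi = 0 := by
    rw [← r1, ← r2] at h0
    rw [← h0]
    rw [show P * qj * qi * qj = P * qi by
        rw [mul_assoc, mul_assoc, show qj * (qi * qj) = qi by ext <;> simp],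
      show P * qj * qk = P * qi by rw [mul_assoc, show qj * qk = qi by ext <;> simp]]
  rw [show P * qi + P * qi + P * qi = (3 : ℝ) • (P * qi) by module] at e
  rcases mul_eq_zero.1 ((smul_eq_zero.1 e).resolve_left three_ne_zero) with h | h
  · exact hP h
  · rw [h] at ii
    simp at ii

/-! ### The extremal part of the curvature module -/

/-- The positive diagonal entry of `Z'`. -/
def scale (n : ℕ) : ℝ := if n = 2 then 1 / 2 else 1

theorem scale_pos (n : ℕ) : 0 < scale n := by
  unfold scale
  split_ifs <;> norm_num

/-- The diagonal of `Z'`. -/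
def wt (n : ℕ) (hn : 2 ≤ n) (i : Fin (n + 1)) : ℝ :=
  scale n * ((if i = one n hn then 1 else 0) - (if i = Fin.last n then 1 else 0))

theorem sum_wt (n : ℕ) (hn : 2 ≤ n) : ∑ i, wt n hn i = 0 := by
  simp only [wt]
  rw [← Finset.mul_sum, Finset.sum_sub_distrib]
  simp

theorem gradZ'_eq (n : ℕ) (hn : 2 ≤ n) : gradZ' n hn = diagElt n (wt n hn) (sum_wt n hn) := rfl

theorem wt_zero (n : ℕ) (hn : 2 ≤ n) : wt n hn 0 = 0 := by
  simp [wt, (one_ne_zero' hn).symm, (last_ne_zero' hn).symm]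

theorem wt_one (n : ℕ) (hn : 2 ≤ n) : wt n hn (one n hn) = scale n := by
  simp [wt, one_ne_last hn]

theorem wt_last (n : ℕ) (hn : 2 ≤ n) : wt n hn (Fin.last n) = -scale n := by
  simp [wt, (one_ne_last hn).symm]

theorem wt_le (n : ℕ) (hn : 2 ≤ n) (i : Fin (n + 1)) : wt n hn i ≤ scale n := by
  have := scale_pos n
  unfold wt
  split_ifs <;> linarith

theorem wt_lt (n : ℕ) (hn : 2 ≤ n) (i : Fin (n + 1)) (hi : i ≠ one n hn) :
    wt n hn i < scale n := by
  have := scale_pos n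
  unfold wt
  rw [if_neg hi]
  split_ifs <;> linarith

theorem le_wt (n : ℕ) (hn : 2 ≤ n) (i : Fin (n + 1)) : -scale n ≤ wt n hn i := by
  have := scale_pos n
  unfold wt
  split_ifs <;> linarith

theorem lt_wt (n : ℕ) (hn : 2 ≤ n) (i : Fin (n + 1)) (hi : i ≠ Fin.last n) :
    -scale n < wt n hn i := by
  have := scale_pos n
  unfold wt
  rw [if_neg hi]
  split_ifs <;> linarith

/-- The bilinear maps on `𝔤₋₁` with values in `𝔤`, among them the 2-cochains of homogeneity `2`. -/
abbrev Cochain (n : ℕ) : Type := (grading n).gm1 →ₗ[ℝ] (grading n).gm1 →ₗ[ℝ] g n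

/-- The cochain with values in the entry `(1, n)` that depends, through `ψ`, only on the last
coordinates of its arguments. -/
def topCochain (n : ℕ) (hn : 2 ≤ n) (ψ : ℍ[ℝ] →ₗ[ℝ] ℍ[ℝ] →ₗ[ℝ] ℍ[ℝ]) : Cochain n :=
  (ψ.compl₁₂ (coordAt (Fin.last n)) (coordAt (Fin.last n))).compr₂
    (offDiag (one n hn) (Fin.last n) (one_ne_last hn))

theorem topCochain_apply {n : ℕ} (hn : 2 ≤ n) (ψ : ℍ[ℝ] →ₗ[ℝ] ℍ[ℝ] →ₗ[ℝ] ℍ[ℝ])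
    (x y : (grading n).gm1) : topCochain n hn ψ x y =
      offDiag (one n hn) (Fin.last n) (one_ne_last hn)
        (ψ (coordAt (Fin.last n) x) (coordAt (Fin.last n) y)) := rfl

/-- The coefficient of a cochain at the weight `4 · scale n`, the largest weight of `Z'`. -/
def topCoeff {n : ℕ} (hn : 2 ≤ n) (φ : Cochain n) : ℍ[ℝ] →ₗ[ℝ] ℍ[ℝ] →ₗ[ℝ] ℍ[ℝ] :=
  (φ.compl₁₂ (vec (Fin.last n) (last_ne_zero' hn)) (vec (Fin.last n) (last_ne_zero' hn))).compr₂
    (ent (one n hn) (Fin.last n))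

theorem topCoeff_apply {n : ℕ} (hn : 2 ≤ n) (φ : Cochain n) (x y : ℍ[ℝ]) :
    topCoeff hn φ x y = ent (one n hn) (Fin.last n)
      (φ (vec (Fin.last n) (last_ne_zero' hn) x) (vec (Fin.last n) (last_ne_zero' hn) y)) := rfl

theorem topCoeff_topCochain {n : ℕ} (hn : 2 ≤ n) (ψ : ℍ[ℝ] →ₗ[ℝ] ℍ[ℝ] →ₗ[ℝ] ℍ[ℝ]) :
    topCoeff hn (topCochain n hn ψ) = ψ := by
  ext1 x
  ext1 y
  rw [topCoeff_apply, topCochain_apply, ent_offDiag, coordAt_vec, coordAt_vec]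
  simp

/-- A cochain of `Z'`-weight at least `4 · scale n` is concentrated in the top coefficient. -/
theorem eq_topCochain_of_lie_eq {n : ℕ} (hn : 2 ≤ n) {φ : Cochain n} {μ : ℝ}
    (hμ : 4 * scale n ≤ μ) (h : ⁅(gradZ' n hn : (grading n).g0), φ⁆ = μ • φ) :
    φ = topCochain n hn (topCoeff hn φ) := by
  refine cochain_ext fun k l hk hl x y i j => ?_
  have key := ent_diagElt_lie_cochain (wt n hn) (sum_wt n hn) _ (gradZ'_eq n hn) φ k l hk hl x y i j
  rw [h, wt_zero] at key
  have key2 : (wt n hn i - wt n hn j - wt n hn k - wt n hn l - μ) •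
      ent i j (φ (vec k hk x) (vec l hl y)) = 0 := by
    rw [sub_smul, sub_eq_zero, ← add_zero (_ - _ : ℝ), ← mul_zero (2 : ℝ), ← key]
    rfl
  rw [topCochain_apply, ent_offDiag, coordAt_vec, coordAt_vec]
  have b1 := wt_le n hn i
  have b2 := le_wt n hn j
  have b3 := le_wt n hn k
  have b4 := le_wt n hn l
  have van : wt n hn i - wt n hn j - wt n hn k - wt n hn l < 4 * scale n →
      ent i j (φ (vec k hk x) (vec l hl y)) = 0 := fun hlt =>
    (smul_eq_zero.1 key2).resolve_left (by linarith)
  by_cases hi : i = one n hn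
  swap
  · rw [if_neg fun h => hi h.1.symm, van (by linarith [wt_lt n hn i hi])]
  by_cases hj : j = Fin.last n
  swap
  · rw [if_neg fun h => hj h.2.symm, van (by linarith [lt_wt n hn j hj])]
  by_cases hk' : k = Fin.last n
  swap
  · rw [if_neg hk', map_zero, LinearMap.zero_apply, ite_self, van (by linarith [lt_wt n hn k hk'])]
  by_cases hl' : l = Fin.last n
  swap
  · rw [if_neg hl', map_zero, ite_self, van (by linarith [lt_wt n hn l hl'])]
  subst hi hj hk' hl'
  simp [topCoeff_apply]

theorem lie_gradZ'_topCochain {n : ℕ} (hn : 2 ≤ n) (ψ : ℍ[ℝ] →ₗ[ℝ] ℍ[ℝ] →ₗ[ℝ] ℍ[ℝ]) :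
    ⁅(gradZ' n hn : (grading n).g0), topCochain n hn ψ⁆ = (4 * scale n) • topCochain n hn ψ := by
  refine cochain_ext fun k l hk hl x y i j => ?_
  rw [ent_diagElt_lie_cochain (wt n hn) (sum_wt n hn) _ (gradZ'_eq n hn), wt_zero]
  simp only [LinearMap.smul_apply, map_smul]
  rw [topCochain_apply, ent_offDiag, coordAt_vec, coordAt_vec]
  by_cases hi : i = one n hn
  swap
  · rw [if_neg fun h => hi h.1.symm, smul_zero, smul_zero]
  by_cases hj : j = Fin.last n
  swap
  · rw [if_neg fun h => hj h.2.symm, smul_zero, smul_zero]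
  by_cases hk' : k = Fin.last n
  swap
  · rw [if_neg hk', map_zero, LinearMap.zero_apply, ite_self, smul_zero, smul_zero]
  by_cases hl' : l = Fin.last n
  swap
  · rw [if_neg hl', map_zero, ite_self, smul_zero, smul_zero]
  subst hi hj hk' hl'
  rw [wt_one, wt_last]
  congr 1
  ring

/-- Coboundaries take values of smaller weight, as their entries are products of a coordinate of an
argument and a linear form. -/
theorem topCoeff_eq_zero_of_mem_coboundaries {n : ℕ} (hn : 2 ≤ n) {φ : Cochain n}
    (h : φ ∈ coboundaries₂ (grading n)) : topCoeff hn φ = 0 := by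
  obtain ⟨f, hf, h⟩ := h
  have key : ∀ (x : ℍ[ℝ]) (y : (grading n).gm1), ent (one n hn) (Fin.last n)
      ⁅(vec (Fin.last n) (last_ne_zero' hn) x).1, f y⁆ = 0 := fun x y => by
    rw [ent_lie, Finset.sum_eq_zero, Finset.sum_eq_zero, sub_zero]
    · intro k _
      rw [ent_g1 (hf y) (fun h => one_ne_zero' hn h.1), zero_mul]
    · intro k _
      rw [ent_vec, if_neg (fun h => one_ne_last hn h.1.symm), zero_mul]
  ext1 x
  ext1 y
  rw [topCoeff_apply, h, map_sub, key, key]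
  simp

theorem topCoeff_cocycle {n : ℕ} (hn : 2 ≤ n) {φ : Cochain n} (h : φ ∈ cocycles₂ (grading n)) :
    (∀ x, topCoeff hn φ x x = 0) ∧ ∀ x y z, topCoeff hn φ y z * x - topCoeff hn φ x z * y +
      topCoeff hn φ x y * z = 0 := by
  obtain ⟨h1, h2, h3⟩ := h
  refine ⟨fun x => by rw [topCoeff_apply, h1, map_zero], fun x y z => ?_⟩
  have key : ∀ (x : ℍ[ℝ]) (X : g n), ent (one n hn) 0
      ⁅(vec (Fin.last n) (last_ne_zero' hn) x).1, X⁆ = -(ent (one n hn) (Fin.last n) X * x) := by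
    intro x X
    rw [ent_lie, Finset.sum_eq_zero, Finset.sum_eq_single (Fin.last n), zero_sub, ent_vec,
      if_pos ⟨rfl, rfl⟩]
    · intro k _ hk
      rw [ent_vec, if_neg (fun h => hk h.1.symm), mul_zero]
    · simp
    · intro k _
      rw [ent_vec, if_neg (fun h => one_ne_last hn h.1.symm), zero_mul]
  have := congrArg (ent (one n hn) 0) (h3 (vec (Fin.last n) (last_ne_zero' hn) x)
    (vec (Fin.last n) (last_ne_zero' hn) y) (vec (Fin.last n) (last_ne_zero' hn) z))
  rw [map_add, map_sub, key, key, key, map_zero, ← topCoeff_apply, ← topCoeff_apply,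
    ← topCoeff_apply] at this
  rw [← neg_eq_zero, ← this]
  abel

/-- The class in `H²₂` of a cocycle. -/
def mkH {n : ℕ} (φ : cocycles₂ (grading n)) : CurvatureModule n :=
  LieSubmodule.Quotient.mk' _ φ

theorem mkH_eq_zero {n : ℕ} {φ : cocycles₂ (grading n)} :
    mkH φ = 0 ↔ φ.1 ∈ coboundaries₂ (grading n) :=
  LieSubmodule.Quotient.mk_eq_zero _

/-- The class in `H²₂` of a cocycle concentrated in the top coefficient. -/
def topClass {n : ℕ} (hn : 2 ≤ n) (ψ : ℍ[ℝ] →ₗ[ℝ] ℍ[ℝ] →ₗ[ℝ] ℍ[ℝ])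
    (h : topCochain n hn ψ ∈ cocycles₂ (grading n)) : CurvatureModule n :=
  mkH (Subtype.mk (topCochain n hn ψ) h)

theorem topClass_eq_zero_iff {n : ℕ} {hn : 2 ≤ n} {ψ : ℍ[ℝ] →ₗ[ℝ] ℍ[ℝ] →ₗ[ℝ] ℍ[ℝ]}
    (h : topCochain n hn ψ ∈ cocycles₂ (grading n)) : topClass hn ψ h = 0 ↔ ψ = 0 := by
  constructor
  · intro h0
    rw [← topCoeff_topCochain hn ψ]
    exact topCoeff_eq_zero_of_mem_coboundaries hn (mkH_eq_zero.1 h0)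
  · rintro rfl
    refine mkH_eq_zero.2 ?_
    have : topCochain n hn 0 = 0 := by
      ext1 x
      ext1 y
      exact map_zero (offDiag (one n hn) (Fin.last n) (one_ne_last hn))
    show topCochain n hn 0 ∈ _
    rw [this]
    exact zero_mem (coboundaries₂ (grading n))

theorem lie_topClass_eq_zero_iff {n : ℕ} {hn : 2 ≤ n} {ψ : ℍ[ℝ] →ₗ[ℝ] ℍ[ℝ] →ₗ[ℝ] ℍ[ℝ]}
    (h : topCochain n hn ψ ∈ cocycles₂ (grading n)) (X : g0 n) :
    ⁅X, topClass hn ψ h⁆ = 0 ↔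
      ⁅(X : (grading n).g0), topCochain n hn ψ⁆ ∈ coboundaries₂ (grading n) := by
  exact mkH_eq_zero (φ := ⁅X, Subtype.mk (topCochain n hn ψ) h⁆)

theorem lie_gradZ'_topClass {n : ℕ} (hn : 2 ≤ n) {ψ : ℍ[ℝ] →ₗ[ℝ] ℍ[ℝ] →ₗ[ℝ] ℍ[ℝ]}
    (h : topCochain n hn ψ ∈ cocycles₂ (grading n)) :
    ⁅gradZ' n hn, topClass hn ψ h⁆ = (4 * scale n) • topClass hn ψ h := by
  have : ⁅gradZ' n hn, (Subtype.mk (topCochain n hn ψ) h : cocycles₂ (grading n))⁆ =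
      (4 * scale n) • (Subtype.mk (topCochain n hn ψ) h : cocycles₂ (grading n)) :=
    Subtype.ext (lie_gradZ'_topCochain hn ψ)
  exact congrArg mkH this

theorem eq_zero_of_mem_coboundaries_of_lie_eq {n : ℕ} (hn : 2 ≤ n) {φ : Cochain n} {μ : ℝ}
    (hμ : 4 * scale n ≤ μ) (hφ : φ ∈ coboundaries₂ (grading n))
    (h : ⁅(gradZ' n hn : (grading n).g0), φ⁆ = μ • φ) : φ = 0 := by
  rw [eq_topCochain_of_lie_eq hn hμ h, topCoeff_eq_zero_of_mem_coboundaries hn hφ]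
  ext1 x
  ext1 y
  exact map_zero (offDiag (one n hn) (Fin.last n) (one_ne_last hn))

/-- An eigenvector of `Z'` in `H²₂` whose eigenvalue is at least `4 · scale n` is the class of a
cocycle concentrated in the top coefficient. -/
theorem exists_topCochain {n : ℕ} (hn : 2 ≤ n) {w : CurvatureModule n} {μ : ℝ}
    (hμ : 4 * scale n ≤ μ) (hw : ⁅gradZ' n hn, w⁆ = μ • w) :
    ∃ (ψ : ℍ[ℝ] →ₗ[ℝ] ℍ[ℝ] →ₗ[ℝ] ℍ[ℝ]) (h : topCochain n hn ψ ∈ cocycles₂ (grading n)),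
      w = topClass hn ψ h := by
  have : Module.Finite ℝ (cocycles₂ (grading n)) :=
    inferInstanceAs (Module.Finite ℝ (cocycles₂ (grading n)).toSubmodule)
  obtain ⟨φ, h1, h2⟩ := exists_eigenvector_lift
    ((coboundaries₂ (grading n)).comap (cocycles₂ (grading n)).incl) (gradZ' n hn) μ
    (fun m hm h => Subtype.ext (eq_zero_of_mem_coboundaries_of_lie_eq hn hμ hm
      (congrArg Subtype.val h))) w hw
  have h' : ⁅(gradZ' n hn : (grading n).g0), φ.1⁆ = μ • φ.1 := congrArg Subtype.val h1
  have e := eq_topCochain_of_lie_eq hn hμ h'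
  have hm : topCochain n hn (topCoeff hn φ.1) ∈ cocycles₂ (grading n) := by
    rw [← e]
    exact φ.2
  have hφ : φ = ⟨_, hm⟩ := Subtype.ext e
  exact ⟨topCoeff hn φ.1, hm, h2.symm.trans (congrArg mkH hφ)⟩

theorem ent_lie_offDiag {n : ℕ} (hn : 2 ≤ n) (X : g n) (q : ℍ[ℝ]) (i j : Fin (n + 1)) :
    ent i j ⁅X, offDiag (one n hn) (Fin.last n) (one_ne_last hn) q⁆ =
      (if j = Fin.last n then ent i (one n hn) X * q else 0) -
        (if i = one n hn then q * ent (Fin.last n) j X else 0) := by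
  rw [ent_lie, Finset.sum_eq_single (one n hn), Finset.sum_eq_single (Fin.last n)]
  · rw [ent_offDiag, ent_offDiag]
    simp only [mul_ite, mul_zero, ite_mul, zero_mul, true_and, and_true, eq_comm]
  · intro k _ hk
    rw [ent_offDiag, if_neg (fun h => hk h.2.symm), zero_mul]
  · simp
  · intro k _ hk
    rw [ent_offDiag, if_neg (fun h => hk h.1.symm), mul_zero]
  · simp

theorem topCochain_mem_cocycles {n : ℕ} (hn : 2 ≤ n) {ψ : ℍ[ℝ] →ₗ[ℝ] ℍ[ℝ] →ₗ[ℝ] ℍ[ℝ]}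
    (halt : ∀ x, ψ x x = 0) (hcyc : ∀ x y z, ψ y z * x - ψ x z * y + ψ x y * z = 0) :
    topCochain n hn ψ ∈ cocycles₂ (grading n) := by
  refine ⟨fun x => ?_, fun x y => ?_, fun x y z => ?_⟩
  · rw [topCochain_apply, halt, map_zero]
  · exact offDiag_mem_g0 (one_ne_last hn) (one_ne_zero' hn) (last_ne_zero' hn) _
  · refine ext_ent fun i j => ?_
    have key : ∀ (x : (grading n).gm1) (q : ℍ[ℝ]),
        ent i j ⁅x.1, offDiag (one n hn) (Fin.last n) (one_ne_last hn) q⁆ =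
        if i = one n hn ∧ j = 0 then -(q * coordAt (Fin.last n) x) else 0 := by
      intro x q
      rw [ent_lie_offDiag, ent_gm1 x.2 (fun h => one_ne_zero' hn h.2), zero_mul, ite_self, zero_sub]
      by_cases hj : j = 0
      · subst hj
        simp only [and_true]
        split_ifs
        · rfl
        · exact neg_zero
      · rw [ent_gm1 x.2 (fun h => hj h.2), mul_zero, ite_self, neg_zero,
          if_neg fun h => hj h.2]
    rw [map_add, map_sub, map_zero]
    rw [topCochain_apply, topCochain_apply, topCochain_apply, key, key, key]
    split_ifs
    · rw [← neg_eq_zero, ← hcyc (coordAt (Fin.last n) x) (coordAt (Fin.last n) y)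
        (coordAt (Fin.last n) z)]
      abel
    · simp

/-- The form `α` with `α(i) = 0`, `α(j) = 1`, `α(k) = i` defines a cocycle; it is a weight vector
for the left multiplications and the conjugations by `exp(ti)`. -/
theorem weylForm_example_mem {n : ℕ} (hn : 2 ≤ n) :
    topCochain n hn (weylForm 0 1 qi) ∈ cocycles₂ (grading n) := by
  refine topCochain_mem_cocycles hn (fun x => ?_) fun x y z => ?_
  · rw [weylForm_apply, imMap_apply]
    ext <;> simp <;> ring
  · simp only [weylForm_apply, imMap_apply]
    ext <;> simp <;> ring

theorem weylForm_ne_zero {P Q R : ℍ[ℝ]} (h : ¬(P = 0 ∧ Q = 0 ∧ R = 0)) : weylForm P Q R ≠ 0 := by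
  intro h0
  have key : ∀ u : ℍ[ℝ], imMap P Q R u = 0 := fun u => by
    have := weylForm_apply P Q R 1 u
    rw [h0, star_one, mul_one] at this
    exact this.symm
  refine h ⟨?_, ?_, ?_⟩
  · simpa [imMap_apply] using key qi
  · simpa [imMap_apply] using key qj
  · simpa [imMap_apply] using key qk

theorem isGreatest_eigenvalue (n : ℕ) (hn : 2 ≤ n) :
    IsGreatest {μ : ℝ | (LieModule.toEnd ℝ (g0 n) (CurvatureModule n)
      (gradZ' n hn)).HasEigenvalue μ} (4 * scale n) := by
  constructor
  · refine Module.End.hasEigenvalue_of_hasEigenvector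
      (x := topClass hn _ (weylForm_example_mem hn)) ⟨?_, ?_⟩
    · rw [Module.End.mem_eigenspace_iff]
      exact lie_gradZ'_topClass hn _
    · intro h0
      exact weylForm_ne_zero (by simp) ((topClass_eq_zero_iff _).1 h0)
  · intro μ hμ
    obtain ⟨w, hw, hw0⟩ := Module.End.HasEigenvalue.exists_hasEigenvector hμ
    rw [Module.End.mem_eigenspace_iff] at hw
    by_contra hlt
    rw [not_le] at hlt
    obtain ⟨ψ, h, rfl⟩ := exists_topCochain hn hlt.le hw
    have e : (4 * scale n) • topClass hn ψ h = μ • topClass hn ψ h :=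
      (lie_gradZ'_topClass hn h).symm.trans hw
    rw [← sub_eq_zero, ← sub_smul] at e
    rcases smul_eq_zero.1 e with e | e
    · linarith
    · exact hw0 e

theorem isExtremal_iff {n : ℕ} (hn : 2 ≤ n) (w : CurvatureModule n) :
    IsExtremal n hn w ↔ ⁅gradZ' n hn, w⁆ = (4 * scale n) • w := by
  constructor
  · rintro ⟨θ, h1, h2⟩
    have e : 4 * scale n = θ := (isGreatest_eigenvalue n hn).unique h1
    exact h2.trans (congrArg (fun t : ℝ => t • w) e.symm)
  · exact fun h => ⟨_, isGreatest_eigenvalue n hn, h⟩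

/-- The nonzero extremal elements are the classes of the cocycles given by a nonzero `α` with
`α(i) i + α(j) j + α(k) k = 0`. -/
theorem IsExtremal.exists_weylForm {n : ℕ} {hn : 2 ≤ n} {w : CurvatureModule n}
    (hw : IsExtremal n hn w) (h0 : w ≠ 0) :
    ∃ (P Q R : ℍ[ℝ]) (h : topCochain n hn (weylForm P Q R) ∈ cocycles₂ (grading n)),
      P * qi + Q * qj + R * qk = 0 ∧ ¬(P = 0 ∧ Q = 0 ∧ R = 0) ∧ w = topClass hn _ h := by
  obtain ⟨ψ, h, rfl⟩ := exists_topCochain hn le_rfl ((isExtremal_iff hn w).1 hw)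
  obtain ⟨halt, hcyc⟩ := topCoeff_cocycle hn h
  rw [topCoeff_topCochain] at halt hcyc
  obtain ⟨P, Q, R, hPQR, rfl⟩ := exists_eq_weylForm ψ halt hcyc
  refine ⟨P, Q, R, h, hPQR, ?_, rfl⟩
  rintro ⟨rfl, rfl, rfl⟩
  apply h0
  rw [topClass_eq_zero_iff]
  ext1 x
  ext1 y
  rw [weylForm_apply, imMap_apply]
  simp

/-! ### The annihilator of an extremal element -/

/-- Membership in the parabolic subalgebra of `𝔤₀` with nilradical `𝔥₊`: in the block `A`, all
entries below the diagonal of the first column and left of the diagonal of the last row vanish. -/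
def InParabolic {n : ℕ} (hn : 2 ≤ n) (X : g n) : Prop :=
  (∀ i, i ≠ one n hn → ent i (one n hn) X = 0) ∧
    ∀ j, j ≠ Fin.last n → ent (Fin.last n) j X = 0

/-- The action of diagonal entries `p, q, c` on the form `α(y x̄)` depends on `c` only through its
real part: this is the invariance under the summand `𝔰𝔭(1)`. -/
theorem weylForm_lie (P Q R p q c x y : ℍ[ℝ]) :
    p * weylForm P Q R x y - weylForm P Q R x y * q - weylForm P Q R x (q * y - y * c)
      - weylForm P Q R (q * x - x * c) y =
    p * imMap P Q R (y * star x) - imMap P Q R (y * star x) * q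
      - imMap P Q R (y * star x * star q + q * (y * star x))
      + (2 * c.re) • imMap P Q R (y * star x) := by
  simp only [weylForm_apply]
  have e : y * star x * star q + q * (y * star x) - (2 * c.re) • (y * star x) =
      (q * y - y * c) * star x + y * star (q * x - x * c) := by
    have hc : (2 * c.re) • (y * star x) = y * (c + star c) * star x := by
      rw [Quaternion.self_add_star', ← Quaternion.coe_commutes, mul_assoc,
        Quaternion.coe_mul_eq_smul]
    rw [hc, star_sub, star_mul, star_mul]
    noncomm_ring
  have := congrArg (imMap P Q R) e
  rw [map_sub, map_add _ (_ * star x), map_smul] at this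
  rw [sub_sub _ (imMap P Q R _) (imMap P Q R _), ← this]
  abel

theorem topCoeff_lie {n : ℕ} (hn : 2 ≤ n) (X : (grading n).g0)
    (ψ : ℍ[ℝ] →ₗ[ℝ] ℍ[ℝ] →ₗ[ℝ] ℍ[ℝ]) (x y : ℍ[ℝ]) :
    topCoeff hn ⁅X, topCochain n hn ψ⁆ x y =
      ent (one n hn) (one n hn) X.1 * ψ x y - ψ x y * ent (Fin.last n) (Fin.last n) X.1
      - ψ x (ent (Fin.last n) (Fin.last n) X.1 * y - y * ent 0 0 X.1)
      - ψ (ent (Fin.last n) (Fin.last n) X.1 * x - x * ent 0 0 X.1) y := by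
  have hc : ∀ y, coordAt (Fin.last n) ⁅X, vec (Fin.last n) (last_ne_zero' hn) y⁆ =
      ent (Fin.last n) (Fin.last n) X.1 * y - y * ent 0 0 X.1 := fun y => by
    rw [coordAt_lie, Finset.sum_eq_single (Fin.last n), coordAt_vec, if_pos rfl]
    · intro l _ hl
      rw [coordAt_vec, if_neg hl.symm, mul_zero]
    · simp
  rw [topCoeff_apply, lie_cochain_grading_apply, topCochain_apply, topCochain_apply,
    topCochain_apply, hc, hc, map_sub, map_sub, ent_lie_offDiag, ent_offDiag, ent_offDiag,
    coordAt_vec, coordAt_vec]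
  simp

theorem lie_topCochain {n : ℕ} (hn : 2 ≤ n) (X : (grading n).g0) (hX : InParabolic hn X.1)
    (ψ : ℍ[ℝ] →ₗ[ℝ] ℍ[ℝ] →ₗ[ℝ] ℍ[ℝ])
    (h : ∀ x y, ent (one n hn) (one n hn) X.1 * ψ x y
      - ψ x y * ent (Fin.last n) (Fin.last n) X.1
      - ψ x (ent (Fin.last n) (Fin.last n) X.1 * y - y * ent 0 0 X.1)
      - ψ (ent (Fin.last n) (Fin.last n) X.1 * x - x * ent 0 0 X.1) y = 0) :
    ⁅X, topCochain n hn ψ⁆ = 0 := by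
  ext1 x
  ext1 y
  refine ext_ent fun i j => ?_
  have hc : ∀ y, coordAt (Fin.last n) ⁅X, y⁆ = ent (Fin.last n) (Fin.last n) X.1 *
      coordAt (Fin.last n) y - coordAt (Fin.last n) y * ent 0 0 X.1 := fun y => by
    rw [coordAt_lie, Finset.sum_eq_single (Fin.last n)]
    · intro l _ hl
      rw [hX.2 l hl, zero_mul]
    · simp
  rw [lie_cochain_grading_apply, topCochain_apply, topCochain_apply,
    topCochain_apply, hc, hc, map_sub, map_sub, ent_lie_offDiag, ent_offDiag, ent_offDiag]
  show _ = ent i j (0 : g n)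
  rw [map_zero]
  by_cases hi : i = one n hn
  · by_cases hj : j = Fin.last n
    · subst hi hj
      simpa using h (coordAt (Fin.last n) x) (coordAt (Fin.last n) y)
    · rw [if_neg hj, hX.2 j hj, mul_zero, ite_self, if_neg fun h => hj h.2.symm,
        if_neg fun h => hj h.2.symm]
      simp
  · rw [hX.1 i hi, if_neg hi, zero_mul, ite_self, if_neg fun h => hi h.1.symm,
        if_neg fun h => hi h.1.symm]
    simp

theorem lie_mem_ann {L : Type} [LieRing L] [LieAlgebra ℝ L] (G : Grading L) (w : H₂₂ G)
    {A B : G.g0} (hA : A ∈ ann G w) (hB : B ∈ ann G w) : ⁅A, B⁆ ∈ ann G w :=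
  (ann G w).lie_mem hA hB

theorem mem_ann_iff_lie {n : ℕ} (w : CurvatureModule n) (X : g0 n) :
    X ∈ ann (grading n) w ↔ ⁅X, w⁆ = 0 := Iff.rfl

/-- The diagonal entries `(a, A₁₁, Aₙₙ)` of `X` satisfy the stabilizer condition. -/
def StabEnt {n : ℕ} (hn : 2 ≤ n) (P Q R : ℍ[ℝ]) (X : g n) : Prop :=
  Stab P Q R (ent (one n hn) (one n hn) X) (ent (Fin.last n) (Fin.last n) X) (ent 0 0 X).re

theorem mem_ann_of_inParabolic {n : ℕ} (hn : 2 ≤ n) {P Q R : ℍ[ℝ]}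
    (h : topCochain n hn (weylForm P Q R) ∈ cocycles₂ (grading n)) (X : g0 n)
    (hX : InParabolic hn X.1) (hs : StabEnt hn P Q R X.1) :
    X ∈ ann (grading n) (topClass hn _ h) := by
  rw [mem_ann_iff_lie, lie_topClass_eq_zero_iff]
  have e : ⁅(X : (grading n).g0), topCochain n hn (weylForm P Q R)⁆ = 0 :=
    lie_topCochain hn X hX _ fun x y => by
      rw [weylForm_lie]
      exact hs _
  rw [e]
  exact zero_mem (coboundaries₂ (grading n))

theorem stabEnt_of_mem_ann {n : ℕ} (hn : 2 ≤ n) {P Q R : ℍ[ℝ]}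
    (h : topCochain n hn (weylForm P Q R) ∈ cocycles₂ (grading n)) (X : g0 n)
    (hX : X ∈ ann (grading n) (topClass hn _ h)) : StabEnt hn P Q R X.1 := by
  rw [mem_ann_iff_lie, lie_topClass_eq_zero_iff] at hX
  intro v
  have := topCoeff_lie hn X (weylForm P Q R) 1 v
  rw [weylForm_lie, star_one, mul_one] at this
  have h0 := topCoeff_eq_zero_of_mem_coboundaries hn hX
  exact this.symm.trans (DFunLike.congr_fun (DFunLike.congr_fun h0 1) v)

theorem stab_zero (P Q R : ℍ[ℝ]) : Stab P Q R 0 0 0 := by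
  intro v
  simp

/-- Brackets with elements of `𝔥₊` move the entries of negative `Z'`-weight to the diagonal, where
they contradict the stabilizer condition. -/
theorem inParabolic_of_mem_ann {n : ℕ} (hn : 2 ≤ n) {P Q R : ℍ[ℝ]}
    (hPQR : ¬(P = 0 ∧ Q = 0 ∧ R = 0))
    (h : topCochain n hn (weylForm P Q R) ∈ cocycles₂ (grading n)) (X : g0 n)
    (hX : X ∈ ann (grading n) (topClass hn _ h)) : InParabolic hn X.1 := by
  have main : ∀ (i j : Fin (n + 1)) (hij : i ≠ j) (hi0 : i ≠ 0) (hj0 : j ≠ 0)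
      (_ : i = one n hn ∨ j = Fin.last n) (y : ℍ[ℝ]),
      StabEnt hn P Q R ⁅offDiag i j hij y, X.1⁆ := by
    intro i j hij hi0 hj0 hor y
    let Y : g0 n := ⟨offDiag i j hij y, offDiag_mem_g0 hij hi0 hj0 y⟩
    have hY : Y ∈ ann (grading n) (topClass hn _ h) := by
      refine mem_ann_of_inParabolic hn h Y ⟨fun k hk => ?_, fun k hk => ?_⟩ ?_
      · show ent _ _ (offDiag i j hij y) = 0
        rw [ent_offDiag, if_neg]
        rintro ⟨rfl, rfl⟩
        exact hor.elim (fun h => hk h) fun h => one_ne_last hn h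
      · show ent _ _ (offDiag i j hij y) = 0
        rw [ent_offDiag, if_neg]
        rintro ⟨rfl, rfl⟩
        exact hor.elim (fun h => one_ne_last hn h.symm) fun h => hk h
      · have hd : ∀ k, ent k k (offDiag i j hij y) = 0 := fun k => by
          rw [ent_offDiag, if_neg]
          rintro ⟨rfl, rfl⟩
          exact hij rfl
        show Stab _ _ _ _ _ _
        rw [hd, hd, hd]
        exact stab_zero P Q R
    exact stabEnt_of_mem_ann hn h ⁅Y, X⁆ (lie_mem_ann (grading n) _ hY hX)
  -- The diagonal entries of the bracket of `y E_{ij}` with `X`.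
  have hent : ∀ (i j : Fin (n + 1)) (hij : i ≠ j) (y : ℍ[ℝ]) (k : Fin (n + 1)),
      ent k k ⁅offDiag i j hij y, X.1⁆ =
      (if k = i then y * ent j i X.1 else 0) - if k = j then ent j i X.1 * y else 0 := by
    intro i j hij y k
    rw [ent_lie, Finset.sum_eq_single j, Finset.sum_eq_single i, ent_offDiag, ent_offDiag]
    · by_cases h1 : k = i <;> by_cases h2 : k = j
      · subst h1
        simp [h2]
      · subst h1
        simp [h2, Ne.symm h2]
      · subst h2
        simp [h1, Ne.symm h1]
      · simp [h1, h2, Ne.symm h1, Ne.symm h2]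
    · intro l _ hl
      rw [ent_offDiag, if_neg fun h => hl h.1.symm, mul_zero]
    · simp
    · intro l _ hl
      rw [ent_offDiag, if_neg fun h => hl h.2.symm, zero_mul]
    · simp
  have hre : ∀ (i j : Fin (n + 1)) (hij : i ≠ j) (hi0 : i ≠ 0) (hj0 : j ≠ 0)
      (_ : i = one n hn ∨ j = Fin.last n), ent j i X.1 = 0 := by
    intro i j hij hi0 hj0 hor
    by_contra hne
    have hs := main i j hij hi0 hj0 hor (ent j i X.1)⁻¹
    have := Stab.re_eq hPQR hs
    rw [hent, hent, hent, inv_mul_cancel₀ hne, mul_inv_cancel₀ hne, if_neg hi0.symm,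
      if_neg hj0.symm] at this
    have h1l := one_ne_last hn
    by_cases hi : i = one n hn <;> by_cases hj : j = Fin.last n
    · subst hi hj
      rw [if_pos rfl, if_neg h1l, if_neg h1l.symm, if_pos rfl] at this
      norm_num at this
    · subst hi
      rw [if_pos rfl, if_neg hij, if_neg h1l.symm, if_neg (Ne.symm hj)] at this
      norm_num at this
    · subst hj
      rw [if_neg (Ne.symm hi), if_neg h1l, if_neg (Ne.symm hij), if_pos rfl] at this
      norm_num at this
    · exact hor.elim hi hj
  refine ⟨fun i hi => ?_, fun j hj => ?_⟩
  · by_cases hi0 : i = 0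
    · exact ent_g0 X.2 fun h => one_ne_zero' hn (h.1 hi0)
    · exact hre _ _ (Ne.symm hi) (one_ne_zero' hn) hi0 (Or.inl rfl)
  · by_cases hj0 : j = 0
    · exact ent_g0 X.2 fun h => last_ne_zero' hn (h.2 hj0)
    · exact hre _ _ hj hj0 (last_ne_zero' hn) (Or.inr rfl)

theorem mem_ann_iff {n : ℕ} (hn : 2 ≤ n) {P Q R : ℍ[ℝ]} (hPQR : ¬(P = 0 ∧ Q = 0 ∧ R = 0))
    (h : topCochain n hn (weylForm P Q R) ∈ cocycles₂ (grading n)) (X : g0 n) :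
    X ∈ ann (grading n) (topClass hn _ h) ↔ InParabolic hn X.1 ∧ StabEnt hn P Q R X.1 :=
  ⟨fun hX => ⟨inParabolic_of_mem_ann hn hPQR h X hX, stabEnt_of_mem_ann hn h X hX⟩,
    fun hX => mem_ann_of_inParabolic hn h X hX.1 hX.2⟩

/-! ### Elements of `𝔤₀` by blocks of rows and columns -/

/-- The indices of the middle block. -/
def mid {n : ℕ} (m : Fin (n - 2)) : Fin (n + 1) := ⟨m.val + 2, by omega⟩

theorem mid_ne_zero {n : ℕ} (m : Fin (n - 2)) : mid m ≠ 0 := by simp [mid, Fin.ext_iff]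

theorem mid_ne_one {n : ℕ} (hn : 2 ≤ n) (m : Fin (n - 2)) : mid m ≠ one n hn := by
  simp [mid, one, Fin.ext_iff]

theorem mid_ne_last {n : ℕ} (m : Fin (n - 2)) : mid m ≠ Fin.last n := by
  have := m.2
  simp only [mid, ne_eq, Fin.ext_iff, Fin.val_last]
  omega

theorem index_cases {n : ℕ} (hn : 2 ≤ n) (i : Fin (n + 1)) :
    i = 0 ∨ i = one n hn ∨ (∃ m, i = mid m) ∨ i = Fin.last n := by
  simp only [Fin.ext_iff, one, Fin.val_last, Fin.val_zero, mid]
  by_cases h0 : i.val = 0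
  · exact Or.inl h0
  by_cases h1 : i.val = 1
  · exact Or.inr (Or.inl h1)
  by_cases h2 : i.val = n
  · exact Or.inr (Or.inr (Or.inr h2))
  exact Or.inr (Or.inr (Or.inl ⟨⟨i.val - 2, by omega⟩, by simp; omega⟩))

theorem sum_index {M : Type*} [AddCommMonoid M] {n : ℕ} (hn : 2 ≤ n) (f : Fin (n + 1) → M) :
    ∑ i, f i = f 0 + (f (one n hn) + (∑ m, f (mid m) + f (Fin.last n))) := by
  obtain ⟨m, rfl⟩ := Nat.exists_eq_add_of_le' hn
  rw [Fin.sum_univ_succ, Fin.sum_univ_succ, Fin.sum_univ_castSucc]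
  rfl

theorem coe_lie_g0 {n : ℕ} (X Y : g0 n) : (⁅X, Y⁆ : g0 n).1 = ⁅X.1, Y.1⁆ := rfl

theorem ext_ent_g0 {n : ℕ} {X Y : g0 n} (h : ∀ i j, ent i j X.1 = ent i j Y.1) : X = Y :=
  Subtype.ext (ext_ent h)

theorem ent_g0_zero_left {n : ℕ} (X : g0 n) {j : Fin (n + 1)} (hj : j ≠ 0) : ent 0 j X.1 = 0 :=
  ent_g0 X.2 fun h => hj (h.1 rfl)

theorem ent_g0_zero_right {n : ℕ} (X : g0 n) {i : Fin (n + 1)} (hi : i ≠ 0) : ent i 0 X.1 = 0 :=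
  ent_g0 X.2 fun h => hi (h.2 rfl)

/-- The entries of an element of `𝔤₀` as a linear form. -/
def ent0 {n : ℕ} (i j : Fin (n + 1)) : g0 n →ₗ[ℝ] ℍ[ℝ] := ent i j ∘ₗ (g0 n).toSubmodule.subtype

theorem ent0_apply {n : ℕ} (i j : Fin (n + 1)) (X : g0 n) : ent0 i j X = ent i j X.1 := rfl

theorem re_sum {ι : Type*} (s : Finset ι) (f : ι → ℍ[ℝ]) :
    (∑ i ∈ s, f i).re = ∑ i ∈ s, (f i).re :=
  map_sum (⟨⟨fun q : ℍ[ℝ] => q.re, rfl⟩, fun _ _ => rfl⟩ : ℍ[ℝ] →+ ℝ) f s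

theorem re_sum_diag {n : ℕ} (X : g n) : ∑ i, (ent i i X).re = 0 := by
  rw [← re_sum]
  exact X.2

/-- An element of `𝔤₀` from its entries. -/
def mkG0 {n : ℕ} (f : Fin (n + 1) → Fin (n + 1) → ℍ[ℝ]) (h0 : ∑ i, (f i i).re = 0)
    (h1 : ∀ i j, ¬(i = 0 ↔ j = 0) → f i j = 0) : g0 n :=
  ⟨⟨Matrix.of f, (re_sum Finset.univ fun i => f i i).trans h0⟩, h1⟩

theorem ent_mkG0 {n : ℕ} (f : Fin (n + 1) → Fin (n + 1) → ℍ[ℝ]) (h0 : ∑ i, (f i i).re = 0)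
    (h1 : ∀ i j, ¬(i = 0 ↔ j = 0) → f i j = 0) (i j : Fin (n + 1)) :
    ent i j (mkG0 f h0 h1).1 = f i j := rfl

/-- The diagonal element of `𝔤₀` with imaginary entries. -/
def diagIm {n : ℕ} (d : Fin (n + 1) → ℍ[ℝ]) (h : ∀ i, (d i).re = 0) : g0 n :=
  mkG0 (fun i j => if i = j then d i else 0)
    (Finset.sum_eq_zero fun i _ => by rw [if_pos rfl, h]) fun i j hij =>
      if_neg fun h => hij (by rw [h])

theorem ent_diagIm {n : ℕ} (d : Fin (n + 1) → ℍ[ℝ]) (h : ∀ i, (d i).re = 0)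
    (i j : Fin (n + 1)) : ent i j (diagIm d h).1 = if i = j then d i else 0 := rfl

theorem mem_spAt_iff {n : ℕ} {k : Fin (n + 1)} {X : g0 n} :
    X ∈ spAt n k ↔ ∀ i j, ¬(i = k ∧ j = k) → ent i j X.1 = 0 := Iff.rfl

theorem re_of_mem_spAt {n : ℕ} {k : Fin (n + 1)} {X : g0 n} (hX : X ∈ spAt n k) :
    (ent k k X.1).re = 0 := by
  have h := re_sum_diag X.1
  rw [Finset.sum_eq_single k] at h
  · exact h
  · intro i _ hi
    rw [mem_spAt_iff.1 hX i i fun h => hi h.1]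
    rfl
  · simp

theorem mem_hplus_iff {n : ℕ} (hn : 2 ≤ n) {X : g0 n} :
    X ∈ hplus n ↔ ent 0 0 X.1 = 0 ∧ ∀ i j, i ≠ 0 → j ≠ 0 →
      ¬((i = one n hn ∨ j = Fin.last n) ∧ i ≠ j) → ent i j X.1 = 0 := by
  refine and_congr Iff.rfl ⟨fun h i j hi hj hij => ?_, fun h i j hij => ?_⟩
  · obtain ⟨i, rfl⟩ := Fin.exists_succ_eq.2 hi
    obtain ⟨j, rfl⟩ := Fin.exists_succ_eq.2 hj
    refine h i j fun h' => hij ?_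
    simp only [one, ne_eq, Fin.ext_iff, Fin.val_succ, Fin.val_last] at h' ⊢
    omega
  · refine h i.succ j.succ (Fin.succ_ne_zero i) (Fin.succ_ne_zero j) fun h' => hij ?_
    simp only [one, ne_eq, Fin.ext_iff, Fin.val_succ, Fin.val_last] at h' ⊢
    omega

/-! ### The summand `𝔰𝔬(2)` -/

/-- The subalgebra `𝔰𝔭(1)_left ⊕ 𝔰𝔭(1)_right`. -/
def spLR (n : ℕ) (hn : 2 ≤ n) : LieSubalgebra ℝ (g0 n) where
  carrier := {X | (∀ i j, ¬(i = j ∧ (i = one n hn ∨ i = Fin.last n)) → ent i j X.1 = 0) ∧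
    ∀ i, (ent i i X.1).re = 0}
  add_mem' {X Y} hX hY := ⟨fun i j h => by
      have := map_add (ent0 i j) X Y
      rwa [ent0_apply, ent0_apply, ent0_apply, hX.1 i j h, hY.1 i j h, add_zero] at this,
    fun i => by
      have := congrArg (fun q : ℍ[ℝ] => q.re) (map_add (ent0 i i) X Y)
      simp only [ent0_apply, Quaternion.re_add, hX.2, hY.2, add_zero] at this
      exact this⟩
  zero_mem' := ⟨fun i j _ => map_zero (ent0 i j), fun i => by
    have := congrArg (fun q : ℍ[ℝ] => q.re) (map_zero (ent0 (n := n) i i))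
    exact this⟩
  smul_mem' c X hX := ⟨fun i j h => by
      have := map_smul (ent0 i j) c X
      rwa [ent0_apply, ent0_apply, hX.1 i j h, smul_zero] at this,
    fun i => by
      have := congrArg (fun q : ℍ[ℝ] => q.re) (map_smul (ent0 i i) c X)
      simp only [ent0_apply, Quaternion.re_smul, hX.2, smul_zero] at this
      exact this⟩
  lie_mem' {X Y} hX hY := by
    have key : ∀ i j, ent i j (⁅X, Y⁆ : g0 n).1 =
        ent i i X.1 * ent i j Y.1 - ent i i Y.1 * ent i j X.1 := by
      intro i j
      rw [coe_lie_g0, ent_lie, Finset.sum_eq_single i, Finset.sum_eq_single i]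
      · intro k _ hk
        rw [hY.1 i k fun h => hk h.1.symm, zero_mul]
      · simp
      · intro k _ hk
        rw [hX.1 i k fun h => hk h.1.symm, zero_mul]
      · simp
    refine ⟨fun i j h => ?_, fun i => ?_⟩
    · rw [key, hX.1 i j h, hY.1 i j h, mul_zero, mul_zero, sub_zero]
    · rw [key]
      simp only [Quaternion.re_sub, Quaternion.re_mul]
      ring

theorem spLR_le (n : ℕ) (hn : 2 ≤ n) : (spLR n hn).toSubmodule ≤ sp1Left n hn ⊔ sp1Right n := by
  intro X hX
  have h1l := one_ne_last hn
  have e : X = diagIm (fun i => if i = one n hn then ent i i X.1 else 0)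
      (fun i => by split_ifs; exacts [hX.2 i, rfl]) +
      diagIm (fun i => if i = Fin.last n then ent i i X.1 else 0)
      (fun i => by split_ifs; exacts [hX.2 i, rfl]) := by
    refine ext_ent_g0 fun i j => ?_
    rw [← ent0_apply i j (_ + _), map_add, ent0_apply, ent0_apply, ent_diagIm, ent_diagIm]
    by_cases hij : i = j
    · subst hij
      by_cases h1 : i = one n hn
      · simp [h1, h1l]
      · by_cases h2 : i = Fin.last n
        · simp [h2, h1l.symm]
        · simp [h1, h2, hX.1 i i]
    · simp [hij, hX.1 i j]
  rw [e]
  refine Submodule.add_mem_sup (mem_spAt_iff.2 fun i j h => ?_)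
    (mem_spAt_iff.2 fun i j h => ?_)
  · rw [ent_diagIm]
    split_ifs with h1 h2
    · exact absurd ⟨h2, h1 ▸ h2⟩ h
    · rfl
    · rfl
  · rw [ent_diagIm]
    split_ifs with h1 h2
    · exact absurd ⟨h2, h1 ▸ h2⟩ h
    · rfl
    · rfl

theorem lie_eq_zero_of_finrank_eq_one {L : Type*} [LieRing L] [LieAlgebra ℝ L]
    (h : Module.finrank ℝ L = 1) (x y : L) : ⁅x, y⁆ = 0 := by
  obtain ⟨v, _, hv⟩ := finrank_eq_one_iff'.1 h
  obtain ⟨a, rfl⟩ := hv x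
  obtain ⟨b, rfl⟩ := hv y
  rw [lie_smul, smul_lie, lie_self, smul_zero, smul_zero]

theorem nonempty_lieEquiv_of_finrank_eq_one {L L' : Type*} [LieRing L] [LieAlgebra ℝ L]
    [LieRing L'] [LieAlgebra ℝ L'] (h : Module.finrank ℝ L = 1) (h' : Module.finrank ℝ L' = 1) :
    Nonempty (L ≃ₗ⁅ℝ⁆ L') := by
  have : Module.Finite ℝ L := Module.finite_of_finrank_eq_succ h
  have : Module.Finite ℝ L' := Module.finite_of_finrank_eq_succ h'
  let e : L ≃ₗ[ℝ] L' := LinearEquiv.ofFinrankEq L L' (h.trans h'.symm)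
  exact ⟨{ e with
    map_lie' := fun {x y} => by
      show e ⁅x, y⁆ = ⁅e x, e y⁆
      rw [lie_eq_zero_of_finrank_eq_one h, lie_eq_zero_of_finrank_eq_one h', map_zero] }⟩

theorem finrank_so_two :
    Module.finrank ℝ (LieAlgebra.Orthogonal.so (Fin 2) ℝ) = 1 := by
  have hJ : !![0, 1; -1, 0] ∈ LieAlgebra.Orthogonal.so (Fin 2) ℝ := by
    rw [LieAlgebra.Orthogonal.mem_so]
    ext i j
    fin_cases i <;> fin_cases j <;> simp
  refine finrank_eq_one (⟨_, hJ⟩ : LieAlgebra.Orthogonal.so (Fin 2) ℝ) (fun h => ?_) fun A => ?_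
  · have := congrFun (congrFun (congrArg Subtype.val h) 0) 1
    simp at this
  · have hA := (LieAlgebra.Orthogonal.mem_so (Fin 2) ℝ A.1).1 A.2
    refine ⟨A.1 0 1, Subtype.ext ?_⟩
    ext i j
    have h := congrFun (congrFun hA i) j
    have h' := congrFun (congrFun hA j) i
    fin_cases i <;> fin_cases j <;> simp at h h' ⊢ <;> linarith

/-- The imaginary part of a diagonal entry. -/
def imAt {n : ℕ} (k : Fin (n + 1)) : g0 n →ₗ[ℝ] Fin 3 → ℝ where
  toFun X := ![(ent0 k k X).imI, (ent0 k k X).imJ, (ent0 k k X).imK]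
  map_add' X Y := by
    rw [map_add]
    ext i
    fin_cases i <;> rfl
  map_smul' c X := by
    rw [map_smul]
    ext i
    fin_cases i <;> rfl

theorem ent_eq_of_imAt_eq {n : ℕ} {k : Fin (n + 1)} {X : g0 n} {q : ℍ[ℝ]}
    (hX : (ent k k X.1).re = q.re) (h : imAt k X = ![q.imI, q.imJ, q.imK]) :
    ent k k X.1 = q := by
  ext
  · exact hX
  · exact congrFun h 0
  · exact congrFun h 1
  · exact congrFun h 2

/-- Expansion of a vector of `ℝ³` in the basis `u, v, u × v`. -/
theorem exists_coeff_of_cross_ne_zero {u v : Fin 3 → ℝ} (h : crossProduct u v ≠ 0)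
    (e : Fin 3 → ℝ) : ∃ a b c : ℝ, e = a • u + b • v + c • crossProduct u v := by
  have hc : crossProduct u v ⬝ᵥ crossProduct u v ≠ 0 := fun h0 => h (dotProduct_self_eq_zero.1 h0)
  set d := crossProduct u v ⬝ᵥ crossProduct u v with hd
  refine ⟨(crossProduct e v ⬝ᵥ crossProduct u v) / d, (crossProduct u e ⬝ᵥ crossProduct u v) / d,
    (e ⬝ᵥ crossProduct u v) / d, ?_⟩
  have key : d • e = (crossProduct e v ⬝ᵥ crossProduct u v) • u +
      (crossProduct u e ⬝ᵥ crossProduct u v) • v +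
      (e ⬝ᵥ crossProduct u v) • crossProduct u v := by
    rw [hd]
    ext i
    fin_cases i <;>
    · simp [cross_apply, dotProduct, Fin.sum_univ_three]
      ring
  rw [div_eq_inv_mul, div_eq_inv_mul, div_eq_inv_mul, mul_smul, mul_smul, mul_smul, ← smul_add,
    ← smul_add, ← key, smul_smul, inv_mul_cancel₀ hc, one_smul]

/-- A Lie algebra of dimension at least two that embeds into `ℝ³` with the cross product is all of
`ℝ³`, as `u × v` is independent of `u` and `v`. -/
theorem surjective_of_one_lt_finrank {k : Type*} [LieRing k] [LieAlgebra ℝ k]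
    (p : k →ₗ[ℝ] Fin 3 → ℝ) (hinj : Function.Injective p)
    (hlie : ∀ X Y, p ⁅X, Y⁆ = (2 : ℝ) • crossProduct (p X) (p Y))
    (hlt : 1 < Module.finrank ℝ k) : Function.Surjective p := by
  intro e
  obtain ⟨X, hX0⟩ : ∃ X : k, X ≠ 0 := by
    have : Nontrivial k := Module.nontrivial_of_finrank_pos (R := ℝ) (by omega)
    exact exists_ne 0
  obtain ⟨Y, hXY⟩ := exists_linearIndependent_pair_of_one_lt_finrank hlt hX0
  have hcross : crossProduct (p X) (p Y) ≠ 0 := by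
    rw [crossProduct_ne_zero_iff_linearIndependent]
    have e : p ∘ ![X, Y] = ![p X, p Y] := by
      funext i
      fin_cases i <;> rfl
    rw [← e]
    exact hXY.map' p (LinearMap.ker_eq_bot.2 hinj)
  obtain ⟨a, b, c, he⟩ := exists_coeff_of_cross_ne_zero hcross e
  have hc : crossProduct (p X) (p Y) = (1 / 2 : ℝ) • p ⁅X, Y⁆ := by
    rw [hlie, smul_smul]
    norm_num
  rw [hc] at he
  have hr : ∀ Z : k, p Z ∈ LinearMap.range p := fun Z => LinearMap.mem_range_self p Z
  have : e ∈ LinearMap.range p := by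
    rw [he]
    exact add_mem (add_mem (Submodule.smul_mem _ _ (hr X)) (Submodule.smul_mem _ _ (hr Y)))
      (Submodule.smul_mem _ _ (Submodule.smul_mem _ _ (hr _)))
  exact this

/-- A nonzero extremal element is annihilated by an at most one-dimensional subalgebra of
`𝔰𝔭(1)_left ⊕ 𝔰𝔭(1)_right`. -/
theorem finrank_spLR_inf_le {n : ℕ} {hn : 2 ≤ n} {P Q R : ℍ[ℝ]} (hPQR : ¬(P = 0 ∧ Q = 0 ∧ R = 0))
    (h0 : P * qi + Q * qj + R * qk = 0) (k : LieSubalgebra ℝ (g0 n))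
    (hk : ∀ X ∈ k, X ∈ spLR n hn ∧ StabEnt hn P Q R X.1) : Module.finrank ℝ k ≤ 1 := by
  by_contra hlt
  rw [not_le] at hlt
  have h00 : ∀ X ∈ k, ent 0 0 X.1 = 0 := fun X hX =>
    (hk X hX).1.1 0 0 fun h => h.2.elim (one_ne_zero' hn).symm (last_ne_zero' hn).symm
  have hst : ∀ X ∈ k, Stab P Q R (ent (one n hn) (one n hn) X.1)
      (ent (Fin.last n) (Fin.last n) X.1) 0 := fun X hX => by
    have := (hk X hX).2
    unfold StabEnt at this
    rwa [h00 X hX] at this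
  let p : k →ₗ[ℝ] Fin 3 → ℝ := imAt (Fin.last n) ∘ₗ k.toSubmodule.subtype
  have hent : ∀ (X : k) (q : ℍ[ℝ]), q.re = 0 → p X = ![q.imI, q.imJ, q.imK] →
      ent (Fin.last n) (Fin.last n) X.1.1 = q := by
    intro X q hq hX
    exact ent_eq_of_imAt_eq (((hk X.1 X.2).1.2 _).trans hq.symm) hX
  have hinj : Function.Injective p := by
    refine (injective_iff_map_eq_zero p).2 fun X hX => ?_
    have hl := hent X 0 rfl (by rw [hX]; ext i; fin_cases i <;> rfl)
    have hs := hst X.1 X.2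
    rw [hl] at hs
    have h1 := hs.eq_zero hPQR
    apply Subtype.ext
    refine ext_ent_g0 fun i j => ?_
    show _ = ent i j (0 : g n)
    rw [map_zero]
    by_cases hij : i = j ∧ (i = one n hn ∨ i = Fin.last n)
    · obtain ⟨rfl, rfl | rfl⟩ := hij
      · exact h1
      · exact hl
    · exact (hk X.1 X.2).1.1 i j hij
  have hlie : ∀ X Y, p ⁅X, Y⁆ = (2 : ℝ) • crossProduct (p X) (p Y) := fun X Y => by
    have key : ent (Fin.last n) (Fin.last n) (⁅X, Y⁆ : k).1.1 =
        ent (Fin.last n) (Fin.last n) X.1.1 * ent (Fin.last n) (Fin.last n) Y.1.1 -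
        ent (Fin.last n) (Fin.last n) Y.1.1 * ent (Fin.last n) (Fin.last n) X.1.1 := by
      show ent (Fin.last n) (Fin.last n) ⁅X.1.1, Y.1.1⁆ = _
      rw [ent_lie, Finset.sum_eq_single (Fin.last n), Finset.sum_eq_single (Fin.last n)]
      · intro l _ hl
        rw [(hk Y.1 Y.2).1.1 _ l fun h => hl h.1.symm, zero_mul]
      · simp
      · intro l _ hl
        rw [(hk X.1 X.2).1.1 _ l fun h => hl h.1.symm, zero_mul]
      · simp
    rw [cross_apply]
    have hp : ∀ Z : k, p Z = ![(ent (Fin.last n) (Fin.last n) Z.1.1).imI,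
      (ent (Fin.last n) (Fin.last n) Z.1.1).imJ, (ent (Fin.last n) (Fin.last n) Z.1.1).imK] :=
      fun Z => rfl
    rw [hp, hp, hp, key]
    ext i
    fin_cases i <;>
    · simp
      ring
  have hsurj := surjective_of_one_lt_finrank p hinj hlie hlt
  have hall : ∀ q : ℍ[ℝ], q.re = 0 → ∃ A, Stab P Q R A q 0 := fun q hq => by
    obtain ⟨Z, hZ⟩ := hsurj ![q.imI, q.imJ, q.imK]
    have hs := hst Z.1 Z.2
    rw [hent Z q hq hZ] at hs
    exact ⟨_, hs⟩
  obtain ⟨A, hA⟩ := hall qi rfl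
  obtain ⟨B, hB⟩ := hall qj rfl
  obtain ⟨C, hC⟩ := hall qk rfl
  exact not_stab_three hPQR h0 hA hB hC

/-! ### The summands `ℝ` and `𝔤𝔩(n-2, ℍ)` -/

/-- The diagonal of the generator of the summand `ℝ`. -/
def lineDiag (n : ℕ) (hn : 2 ≤ n) (i : Fin (n + 1)) : ℝ :=
  2 * scale n * (if i = 0 then (n : ℝ) / (n + 1) else -1 / (n + 1)) + -1 * wt n hn i

/-- The generator of the summand `ℝ`: as `Z` and `Z'` act on extremal elements by `2` and
`4 · scale n`, this linear combination annihilates them. -/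
def lineElt (n : ℕ) (hn : 2 ≤ n) : g0 n :=
  (2 * scale n) • gradZ n + (-1 : ℝ) • gradZ' n hn

theorem ent_lineElt {n : ℕ} (hn : 2 ≤ n) (i j : Fin (n + 1)) :
    ent i j (lineElt n hn).1 = if i = j then (lineDiag n hn i : ℍ[ℝ]) else 0 := by
  rw [← ent0_apply, lineElt, map_add, map_smul, map_smul, ent0_apply, ent0_apply, gradZ,
    gradZ'_eq, ent_diagElt, ent_diagElt]
  split_ifs with h h'
  · simp only [lineDiag, if_pos h']
    push_cast
    rw [← Quaternion.coe_mul_eq_smul, ← Quaternion.coe_mul_eq_smul]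
    push_cast
    rfl
  · simp only [lineDiag, if_neg h']
    push_cast
    rw [← Quaternion.coe_mul_eq_smul, ← Quaternion.coe_mul_eq_smul]
    push_cast
    rfl
  · simp

theorem lineDiag_zero (n : ℕ) (hn : 2 ≤ n) : lineDiag n hn 0 = 2 * scale n * (n / (n + 1)) := by
  simp [lineDiag, wt_zero]

theorem lineDiag_one (n : ℕ) (hn : 2 ≤ n) :
    lineDiag n hn (one n hn) = 2 * scale n * (-1 / (n + 1)) - scale n := by
  rw [lineDiag, if_neg (one_ne_zero' hn), wt_one]
  ring

theorem lineDiag_last (n : ℕ) (hn : 2 ≤ n) :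
    lineDiag n hn (Fin.last n) = 2 * scale n * (-1 / (n + 1)) + scale n := by
  rw [lineDiag, if_neg (last_ne_zero' hn), wt_last]
  ring

theorem lineDiag_mid {n : ℕ} (hn : 2 ≤ n) (m : Fin (n - 2)) :
    lineDiag n hn (mid m) = 2 * scale n * (-1 / (n + 1)) := by
  rw [lineDiag, if_neg (mid_ne_zero m), wt, if_neg (mid_ne_one hn m), if_neg (mid_ne_last m)]
  ring

theorem lineDiag_zero_ne (n : ℕ) (hn : 2 ≤ n) : lineDiag n hn 0 ≠ 0 := by
  rw [lineDiag_zero]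
  have := scale_pos n
  have : (0 : ℝ) < n := by exact_mod_cast (by omega : 0 < n)
  positivity

theorem lineElt_ne_zero (n : ℕ) (hn : 2 ≤ n) : lineElt n hn ≠ 0 := fun h0 => lineDiag_zero_ne n hn (by
    have := ent_lineElt hn 0 0
    rw [h0, if_pos rfl] at this
    have h1 : ((lineDiag n hn 0 : ℝ) : ℍ[ℝ]) = ((0 : ℝ) : ℍ[ℝ]) :=
      this.symm.trans (map_zero (ent 0 0))
    exact Quaternion.coe_injective h1)

theorem lineDiag_stab (n : ℕ) (hn : 2 ≤ n) :
    lineDiag n hn (one n hn) - 3 * lineDiag n hn (Fin.last n) + 2 * lineDiag n hn 0 = 0 := by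
  rw [lineDiag_zero, lineDiag_one, lineDiag_last]
  have : (n : ℝ) + 1 ≠ 0 := by positivity
  field_simp
  ring

/-- The diagonal of the image of a matrix with real trace `τ` in the embedding of `𝔤𝔩(n-2, ℍ)`,
outside of the middle block: it makes the total real trace vanish and annihilates extremal
elements. -/
def glDiag (n : ℕ) (hn : 2 ≤ n) (τ : ℝ) (i : Fin (n + 1)) : ℝ :=
  if i = one n hn then -(3 / 4) * τ else if i = Fin.last n then -(1 / 4) * τ else 0

/-- The entries of the image of a matrix in the embedding of `𝔤𝔩(n-2, ℍ)`. -/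
def glFun (n : ℕ) (hn : 2 ≤ n) (B : gl (n - 2)) (i j : Fin (n + 1)) : ℍ[ℝ] :=
  if h : (2 ≤ i.val ∧ i.val < n) ∧ 2 ≤ j.val ∧ j.val < n then
    B ⟨i.val - 2, by omega⟩ ⟨j.val - 2, by omega⟩
  else if i = j then (glDiag n hn B.trace.re i : ℍ[ℝ]) else 0

theorem glFun_mid {n : ℕ} (hn : 2 ≤ n) (B : gl (n - 2)) (k l : Fin (n - 2)) :
    glFun n hn B (mid k) (mid l) = B k l := by
  have := k.2
  have := l.2
  rw [glFun, dif_pos (by simp only [mid]; omega)]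
  rfl

theorem glFun_zero_left {n : ℕ} (hn : 2 ≤ n) (B : gl (n - 2)) (j : Fin (n + 1)) :
    glFun n hn B 0 j = 0 := by
  rw [glFun, dif_neg (by simp), glDiag, if_neg (one_ne_zero' hn).symm,
    if_neg (last_ne_zero' hn).symm]
  simp

theorem glFun_zero_right {n : ℕ} (hn : 2 ≤ n) (B : gl (n - 2)) (i : Fin (n + 1)) :
    glFun n hn B i 0 = 0 := by
  rw [glFun, dif_neg (by simp)]
  split_ifs with h
  · rw [h, glDiag, if_neg (one_ne_zero' hn).symm, if_neg (last_ne_zero' hn).symm]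
    simp
  · rfl

theorem glFun_one_left {n : ℕ} (hn : 2 ≤ n) (B : gl (n - 2)) (j : Fin (n + 1)) :
    glFun n hn B (one n hn) j =
      if one n hn = j then ((-(3 / 4) * B.trace.re : ℝ) : ℍ[ℝ]) else 0 := by
  rw [glFun, dif_neg (by simp [one]), glDiag, if_pos rfl]

theorem glFun_one_right {n : ℕ} (hn : 2 ≤ n) (B : gl (n - 2)) (i : Fin (n + 1)) :
    glFun n hn B i (one n hn) =
      if i = one n hn then ((-(3 / 4) * B.trace.re : ℝ) : ℍ[ℝ]) else 0 := by
  rw [glFun, dif_neg (by simp [one])]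
  split_ifs with h
  · rw [glDiag, if_pos h]
  · rfl

theorem glFun_last_left {n : ℕ} (hn : 2 ≤ n) (B : gl (n - 2)) (j : Fin (n + 1)) :
    glFun n hn B (Fin.last n) j =
      if Fin.last n = j then ((-(1 / 4) * B.trace.re : ℝ) : ℍ[ℝ]) else 0 := by
  rw [glFun, dif_neg (by simp), glDiag, if_neg (one_ne_last hn).symm, if_pos rfl]

theorem glFun_last_right {n : ℕ} (hn : 2 ≤ n) (B : gl (n - 2)) (i : Fin (n + 1)) :
    glFun n hn B i (Fin.last n) =
      if i = Fin.last n then ((-(1 / 4) * B.trace.re : ℝ) : ℍ[ℝ]) else 0 := by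
  rw [glFun, dif_neg (by simp)]
  split_ifs with h
  · rw [glDiag, h, if_neg (one_ne_last hn).symm, if_pos rfl]
  · rfl

theorem glFun_trace {n : ℕ} (hn : 2 ≤ n) (B : gl (n - 2)) :
    ∑ i, (glFun n hn B i i).re = 0 := by
  rw [sum_index hn]
  simp only [glFun_zero_left, glFun_one_left, glFun_mid, glFun_last_left, if_true]
  rw [← re_sum]
  show (0 : ℝ) + (-(3 / 4) * B.trace.re + (B.trace.re + -(1 / 4) * B.trace.re)) = 0
  ring

theorem glFun_off {n : ℕ} (hn : 2 ≤ n) (B : gl (n - 2)) (i j : Fin (n + 1))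
    (h : ¬(i = 0 ↔ j = 0)) : glFun n hn B i j = 0 := by
  by_cases hi : i = 0
  · rw [hi, glFun_zero_left]
  · have hj : j = 0 := by tauto
    rw [hj, glFun_zero_right]

/-- The embedding of `𝔤𝔩(n-2, ℍ)`, as a linear map. -/
def glLin (n : ℕ) (hn : 2 ≤ n) : gl (n - 2) →ₗ[ℝ] g0 n where
  toFun B := mkG0 (glFun n hn B) (glFun_trace hn B) (glFun_off hn B)
  map_add' B C := by
    refine ext_ent_g0 fun i j => ?_
    rw [← ent0_apply i j (_ + _), map_add]
    simp only [ent0_apply, ent_mkG0, glFun, glDiag]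
    split_ifs
    · rfl
    all_goals
      simp only [Matrix.trace_add, Quaternion.re_add, mul_add, Quaternion.coe_add, add_zero,
        Quaternion.coe_zero]
  map_smul' c B := by
    refine ext_ent_g0 fun i j => ?_
    rw [RingHom.id_apply, ← ent0_apply i j (_ • _), map_smul]
    simp only [ent0_apply, ent_mkG0, glFun, glDiag]
    split_ifs
    · rfl
    all_goals
      simp only [Matrix.trace_smul, Quaternion.re_smul, smul_zero, smul_eq_mul, Quaternion.coe_zero]
    all_goals
      rw [← Quaternion.coe_smul, smul_eq_mul]
      congr 1
      ring

theorem ent_glLin {n : ℕ} (hn : 2 ≤ n) (B : gl (n - 2)) (i j : Fin (n + 1)) :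
    ent i j (glLin n hn B).1 = glFun n hn B i j := rfl

/-- The embedding of `𝔤𝔩(n-2, ℍ)` in `𝔤₀`. -/
def glEmb (n : ℕ) (hn : 2 ≤ n) : gl (n - 2) →ₗ⁅ℝ⁆ g0 n :=
  { glLin n hn with
    map_lie' := fun {B C} => by
      refine ext_ent_g0 fun i j => ?_
      show ent i j (glLin n hn ⁅B, C⁆).1 = ent i j ⁅(glLin n hn B).1, (glLin n hn C).1⁆
      have hτ : (⁅B, C⁆ : gl (n - 2)).trace.re = 0 := by
        rw [LieRing.of_associative_ring_bracket, Matrix.trace_sub, Quaternion.re_sub,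
          re_trace_mul_comm, sub_self]
      have h1l := one_ne_last hn
      rw [ent_lie, sum_index hn, sum_index hn]
      simp only [ent_glLin]
      rcases index_cases hn i with rfl | rfl | ⟨k, rfl⟩ | rfl
      · simp [glFun_zero_left]
      · simp only [glFun_one_left, glFun_zero_right, hτ]
        by_cases h : one n hn = j
        · subst h
          generalize -(3 / 4) * B.trace.re = s
          generalize -(3 / 4) * C.trace.re = t
          simp [h1l, (mid_ne_one hn _).symm, Quaternion.coe_commutes s t]
        · simp [h, h1l, (mid_ne_one hn _).symm]
      · rcases index_cases hn j with rfl | rfl | ⟨l, rfl⟩ | rfl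
        · simp [glFun_zero_right]
        · simp [glFun_one_right, mid_ne_one hn, glFun_zero_right, h1l.symm, mid_ne_last,
            glFun_last_right]
        · simp only [glFun_mid, glFun_zero_right, glFun_one_right, glFun_last_right,
            if_neg (mid_ne_one hn k), if_neg (mid_ne_last k), zero_mul, zero_add, add_zero]
          rw [LieRing.of_associative_ring_bracket, Matrix.sub_apply, Matrix.mul_apply,
            Matrix.mul_apply]
        · simp [glFun_one_right, mid_ne_one hn, glFun_zero_right, h1l, mid_ne_last,
            glFun_last_right]
      · simp only [glFun_last_left, glFun_zero_right, hτ]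
        by_cases h : Fin.last n = j
        · subst h
          generalize -(1 / 4) * B.trace.re = s
          generalize -(1 / 4) * C.trace.re = t
          simp [h1l.symm, (mid_ne_last _).symm, Quaternion.coe_commutes s t]
        · simp [h, h1l.symm, (mid_ne_last _).symm] }

theorem ent_glEmb {n : ℕ} (hn : 2 ≤ n) (B : gl (n - 2)) (i j : Fin (n + 1)) :
    ent i j (glEmb n hn B).1 = glFun n hn B i j := rfl

theorem midBlock_apply {n : ℕ} (X : g0 n) (k l : Fin (n - 2)) :
    midBlock X k l = ent (mid k) (mid l) X.1 := rfl

theorem midBlock_glEmb {n : ℕ} (hn : 2 ≤ n) (B : gl (n - 2)) : midBlock (glEmb n hn B) = B := by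
  ext1 k l
  rw [midBlock_apply, ent_glEmb, glFun_mid]

/-! ### Independent families of submodules -/

theorem iSupIndep_of_sum_eq_zero {ι M : Type*} [Fintype ι] [AddCommGroup M] [Module ℝ M]
    (p : ι → Submodule ℝ M) (h : ∀ x : ι → M, (∀ i, x i ∈ p i) → ∑ i, x i = 0 → ∀ i, x i = 0) :
    iSupIndep p := by
  classical
  rw [iSupIndep_iff_finsetSum_eq_zero_imp_eq_zero]
  intro s v hv h0 i hi
  have := h (fun i => if i ∈ s then v i else 0) (fun i => by
    split_ifs with hi
    exacts [hv i hi, zero_mem _]) (by rw [Finset.sum_ite_mem, Finset.univ_inter, h0]) i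
  simpa [hi] using this

theorem finrank_iSup_eq_sum {ι M : Type*} [Fintype ι] [AddCommGroup M] [Module ℝ M]
    [Module.Finite ℝ M] (p : ι → Submodule ℝ M) (h : iSupIndep p) :
    Module.finrank ℝ ↥(⨆ i, p i) = ∑ i, Module.finrank ℝ (p i) := by
  classical
  rw [Submodule.iSup_eq_range_dfinsupp_lsum, LinearMap.finrank_range_of_inj
    h.dfinsupp_lsum_injective]
  exact Module.finrank_directSum ℝ fun i => p i

/-! ### Dimensions of the summands -/

theorem finrank_sp1 (n : ℕ) : Module.finrank ℝ (sp1 n) = 3 := by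
  have hb : Function.Bijective ((imAt 0).comp (sp1 n).subtype) := by
    constructor
    · refine (injective_iff_map_eq_zero _).2 fun X hX => Subtype.ext ?_
      have h0 : ent 0 0 X.1.1 = 0 := ent_eq_of_imAt_eq (re_of_mem_spAt X.2)
        (hX.trans (by ext i; fin_cases i <;> rfl))
      refine ext_ent_g0 fun i j => ?_
      show _ = ent i j (0 : g n)
      rw [map_zero]
      by_cases hij : i = 0 ∧ j = 0
      · rw [hij.1, hij.2, h0]
      · exact mem_spAt_iff.1 X.2 i j hij
    · intro v
      let q : ℍ[ℝ] := ⟨0, v 0, v 1, v 2⟩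
      refine ⟨⟨diagIm (fun i => if i = 0 then q else 0) fun i => by split_ifs <;> rfl,
        mem_spAt_iff.2 fun i j hij => ?_⟩, ?_⟩
      · rw [ent_diagIm]
        split_ifs with h1 h2
        · exact absurd ⟨h2, h1 ▸ h2⟩ hij
        · rfl
        · rfl
      · ext i
        fin_cases i <;> rfl
  rw [(LinearEquiv.ofBijective _ hb).finrank_eq, Module.finrank_fin_fun]

theorem finrank_gl (m : ℕ) : Module.finrank ℝ (gl m) = 4 * m ^ 2 := by
  rw [Module.finrank_matrix, Quaternion.finrank_eq_four, Fintype.card_fin]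
  ring

theorem finrank_range_glEmb (n : ℕ) (hn : 2 ≤ n) :
    Module.finrank ℝ (glEmb n hn).range.toSubmodule = 4 * (n - 2) ^ 2 := by
  have hinj : Function.Injective (glEmb n hn : gl (n - 2) →ₗ[ℝ] g0 n) := fun B C h => by
    rw [← midBlock_glEmb hn B, ← midBlock_glEmb hn C]
    exact congrArg midBlock h
  have := LinearMap.finrank_range_of_inj hinj
  rw [finrank_gl] at this
  exact this

theorem heis_apply {n : ℕ} (M : heis n) {i j : Fin n}
    (h : ¬((i.val = 0 ∨ j.val + 1 = n) ∧ i ≠ j)) : M.1 i j = 0 := M.2 i j h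

/-- An element of `heis (m + 2)` is given by its first row without the diagonal entry and its last
column without the first and the last entry. -/
theorem finrank_heis_add_two (m : ℕ) : Module.finrank ℝ (heis (m + 2)) = 8 * m + 4 := by
  let f : heis (m + 2) →ₗ[ℝ] (Fin (m + 1) → ℍ[ℝ]) × (Fin m → ℍ[ℝ]) :=
    { toFun := fun M => (fun j => M.1 0 j.succ, fun i => M.1 i.castSucc.succ (Fin.last (m + 1)))
      map_add' := fun _ _ => rfl
      map_smul' := fun _ _ => rfl }
  have hb : Function.Bijective f := by
    constructor
    · refine (injective_iff_map_eq_zero f).2 fun M hM => Subtype.ext ?_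
      have h1 : ∀ j : Fin (m + 1), M.1 0 j.succ = 0 := fun j => congrFun (congrArg Prod.fst hM) j
      have h2 : ∀ i : Fin m, M.1 i.castSucc.succ (Fin.last (m + 1)) = 0 := fun i =>
        congrFun (congrArg Prod.snd hM) i
      ext1 i j
      show M.1 i j = 0
      by_cases hij : (i.val = 0 ∨ j.val + 1 = m + 2) ∧ i ≠ j
      · by_cases hi : i = 0
        · subst hi
          obtain ⟨j, rfl⟩ := Fin.exists_succ_eq.2 (Ne.symm hij.2)
          exact h1 j
        · have hj : j = Fin.last (m + 1) := by
            have := hij.1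
            simp only [Fin.ext_iff, Fin.val_zero, Fin.val_last] at hi ⊢
            omega
          subst hj
          obtain ⟨i, rfl⟩ := Fin.exists_succ_eq.2 hi
          have hi' : i ≠ Fin.last m := fun h => hij.2 (by rw [h]; rfl)
          obtain ⟨i, rfl⟩ := Fin.exists_castSucc_eq.2 hi'
          exact h2 i
      · exact heis_apply M hij
    · rintro ⟨u, v⟩
      let M : Matrix (Fin (m + 2)) (Fin (m + 2)) ℍ[ℝ] := Matrix.of fun i j =>
        if hi : i = 0 then (if hj : j = 0 then 0 else u (j.pred hj)) else
          if h : j = Fin.last (m + 1) ∧ i ≠ Fin.last (m + 1) then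
            v ⟨i.val - 1, by
              have h1 := h.2
              simp only [ne_eq, Fin.ext_iff, Fin.val_last, Fin.val_zero] at hi h1
              omega⟩ else 0
      have hM : M ∈ heis (m + 2) := by
        intro i j h
        simp only [M, Matrix.of_apply]
        split_ifs with h1 h2 h3
        · rfl
        · exact absurd ⟨Or.inl (by rw [h1]; rfl), fun h => h2 (h ▸ h1)⟩ h
        · exact absurd ⟨Or.inr (by rw [h3.1]; rfl), fun h => h3.2 (h.trans h3.1)⟩ h
        · rfl
      refine ⟨⟨M, hM⟩, Prod.ext (funext fun j => ?_) (funext fun i => ?_)⟩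
      · show M 0 j.succ = u j
        simp [M, Fin.succ_ne_zero]
      · have hne : i.castSucc.succ ≠ Fin.last (m + 1) := by
          have := i.2
          simp only [ne_eq, Fin.ext_iff, Fin.val_succ, Fin.val_castSucc, Fin.val_last]
          omega
        show M i.castSucc.succ (Fin.last (m + 1)) = v i
        simp [M, hne]
  rw [(LinearEquiv.ofBijective f hb).finrank_eq, Module.finrank_prod, Module.finrank_pi_fintype,
    Module.finrank_pi_fintype]
  simp only [Quaternion.finrank_eq_four, Finset.sum_const, Finset.card_univ, Fintype.card_fin,
    smul_eq_mul]
  ring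

theorem finrank_heis {n : ℕ} (hn : 2 ≤ n) : Module.finrank ℝ (heis n) = 8 * n - 12 := by
  obtain ⟨m, rfl⟩ := Nat.exists_eq_add_of_le' hn
  rw [finrank_heis_add_two]
  omega

theorem block_apply {n : ℕ} (X : g0 n) (i j : Fin n) :
    block X i j = ent i.succ j.succ X.1 := rfl

theorem finrank_hplus {n : ℕ} (hn : 2 ≤ n) : Module.finrank ℝ (hplus n) = 8 * n - 12 := by
  let f : hplus n →ₗ[ℝ] heis n :=
    { toFun := fun X => ⟨block X.1, X.2.2⟩
      map_add' := fun _ _ => rfl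
      map_smul' := fun _ _ => rfl }
  have hb : Function.Bijective f := by
    constructor
    · refine (injective_iff_map_eq_zero f).2 fun X hX => Subtype.ext (ext_ent_g0 fun i j => ?_)
      show _ = ent i j (0 : g n)
      rw [map_zero]
      by_cases hi : i = 0
      · subst hi
        by_cases hj : j = 0
        · subst hj
          exact X.2.1
        · exact ent_g0_zero_left X.1 hj
      · by_cases hj : j = 0
        · subst hj
          exact ent_g0_zero_right X.1 hi
        · obtain ⟨i, rfl⟩ := Fin.exists_succ_eq.2 hi
          obtain ⟨j, rfl⟩ := Fin.exists_succ_eq.2 hj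
          exact congrFun (congrFun (congrArg Subtype.val hX) i) j
    · intro M
      let F : Fin (n + 1) → Fin (n + 1) → ℍ[ℝ] :=
        Fin.cases (fun _ => 0) fun i => Fin.cases 0 fun j => M.1 i j
      have hF : ∀ i j : Fin n, F i.succ j.succ = M.1 i j := fun i j => rfl
      have hFl : ∀ i : Fin (n + 1), F i 0 = 0 := fun i => by
        refine Fin.cases rfl (fun i => rfl) i
      have h0 : ∑ i, (F i i).re = 0 := by
        rw [Fin.sum_univ_succ, Finset.sum_eq_zero, hFl, add_zero]
        · rfl
        · intro i _
          rw [hF, heis_apply M fun h => h.2 rfl]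
          rfl
      have h1 : ∀ i j, ¬(i = 0 ↔ j = 0) → F i j = 0 := fun i j h => by
        by_cases hi : i = 0
        · rw [hi]
          rfl
        · have hj : j = 0 := by tauto
          rw [hj, hFl]
      have hblock : block (mkG0 F h0 h1) = M.1 := by
        ext1 i j
        rw [block_apply, ent_mkG0, hF]
      have hmem : mkG0 F h0 h1 ∈ hplus n := ⟨rfl, by rw [hblock]; exact M.2⟩
      exact ⟨⟨_, hmem⟩, Subtype.ext hblock⟩
  rw [(LinearEquiv.ofBijective f hb).finrank_eq, finrank_heis hn]

theorem finrank_gm1 (n : ℕ) : Module.finrank ℝ (gm1 n) = 4 * n := by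
  let f : (grading n).gm1 →ₗ[ℝ] Fin n → ℍ[ℝ] := LinearMap.pi fun k => coordAt k.succ
  have hb : Function.Bijective f := by
    constructor
    · refine (injective_iff_map_eq_zero f).2 fun v hv => ?_
      rw [eq_sum_vec v]
      refine Finset.sum_eq_zero fun k _ => ?_
      rw [show coordAt k.succ v = 0 from congrFun hv k, map_zero]
    · intro u
      refine ⟨∑ k : Fin n, vec k.succ (Fin.succ_ne_zero k) (u k), funext fun l => ?_⟩
      show coordAt l.succ _ = _
      rw [map_sum, Finset.sum_eq_single l, coordAt_vec, if_pos rfl]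
      · intro k _ hk
        rw [coordAt_vec, if_neg fun h => hk (Fin.succ_injective _ h)]
      · simp
  have := (LinearEquiv.ofBijective f hb).finrank_eq
  rw [Module.finrank_pi_fintype] at this
  simp only [Quaternion.finrank_eq_four, Finset.sum_const, Finset.card_univ, Fintype.card_fin,
    smul_eq_mul] at this
  rw [mul_comm] at this
  exact this

theorem finrank_gradedSum {n : ℕ} (a : LieSubalgebra ℝ (grading n).g0) :
    Module.finrank ℝ (gradedSum (grading n) a) = 4 * n + Module.finrank ℝ a := by
  let f : (gm1 n × a) →ₗ[ℝ] g n := (gm1 n).toSubmodule.subtype.coprod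
    ((g0 n).toSubmodule.subtype ∘ₗ a.toSubmodule.subtype)
  have hf : ∀ x, f x = x.1.1 + x.2.1.1 := fun x => rfl
  have hinj : Function.Injective f := by
    refine (injective_iff_map_eq_zero f).2 fun x hx => ?_
    rw [hf] at hx
    have hx' : ∀ i j, ent i j x.1.1 + ent i j x.2.1.1 = 0 := fun i j => by
      rw [← map_add, hx, map_zero]
    refine Prod.ext (Subtype.ext (ext_ent fun i j => ?_))
      (Subtype.ext (ext_ent_g0 fun i j => ?_))
    · show _ = ent i j (0 : g n)
      rw [map_zero]
      by_cases hij : i ≠ 0 ∧ j = 0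
      · rw [← hx' i j, ent_g0 x.2.1.2 fun h => hij.1 (h.2 hij.2), add_zero]
      · exact ent_gm1 x.1.2 hij
    · show _ = ent i j (0 : g n)
      rw [map_zero]
      by_cases hij : i = 0 ↔ j = 0
      · rw [← hx' i j, ent_gm1 x.1.2 fun h => h.1 (hij.2 h.2), zero_add]
      · exact ent_g0 x.2.1.2 hij
  have hrange : LinearMap.range f = (gradedSum (grading n) a).toSubmodule := by
    ext X
    constructor
    · rintro ⟨⟨v, A⟩, rfl⟩
      exact ⟨v.1, v.2, A.1, A.2, rfl⟩
    · rintro ⟨v, hv, A, hA, rfl⟩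
      exact ⟨(⟨v, hv⟩, ⟨A, hA⟩), rfl⟩
  have h1 := LinearMap.finrank_range_of_inj hinj
  rw [hrange, Module.finrank_prod, finrank_gm1] at h1
  exact h1

/-! ### The shape of the annihilator -/

theorem stab_coe (P Q R : ℍ[ℝ]) {p q r : ℝ} (h : p - 3 * q + 2 * r = 0) :
    Stab P Q R (p : ℍ[ℝ]) (q : ℍ[ℝ]) r := by
  rw [stab_iff]
  have hr : 2 * r = 3 * q - p := by linarith
  simp only [Quaternion.coe_mul_eq_smul, Quaternion.mul_coe_eq_smul, Quaternion.re_coe,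
    Quaternion.imI_coe, Quaternion.imJ_coe, Quaternion.imK_coe, hr]
  refine ⟨?_, ?_, ?_⟩ <;> module

theorem ent_hplus {n : ℕ} {hn : 2 ≤ n} {X : g0 n} (hX : X ∈ hplus n) {i j : Fin (n + 1)}
    (h : ¬(i ≠ 0 ∧ j ≠ 0 ∧ (i = one n hn ∨ j = Fin.last n) ∧ i ≠ j)) : ent i j X.1 = 0 := by
  obtain ⟨h0, h1⟩ := (mem_hplus_iff hn).1 hX
  by_cases hi : i = 0
  · by_cases hj : j = 0
    · rw [hi, hj, h0]
    · rw [hi, ent_g0_zero_left X hj]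
  · by_cases hj : j = 0
    · rw [hj, ent_g0_zero_right X hi]
    · exact h1 i j hi hj fun h' => h ⟨hi, hj, h'⟩

theorem ent_lineElt_lie {n : ℕ} (hn : 2 ≤ n) (X : g0 n) (i j : Fin (n + 1)) :
    ent i j ⁅(lineElt n hn).1, X.1⁆ = (lineDiag n hn i - lineDiag n hn j) • ent i j X.1 := by
  rw [ent_lie]
  simp only [ent_lineElt, ite_mul, mul_ite, zero_mul, mul_zero, Finset.sum_ite_eq,
    Finset.sum_ite_eq', Finset.mem_univ, if_true]
  rw [sub_smul, ← Quaternion.coe_mul_eq_smul, ← Quaternion.coe_mul_eq_smul,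
    Quaternion.coe_commutes (lineDiag n hn j)]

theorem ext_zero_g0 {n : ℕ} {X : g0 n} (h : ∀ i j, ent i j X.1 = 0) : X = 0 :=
  ext_ent_g0 fun i j => (h i j).trans (map_zero (ent i j)).symm

theorem lie_eq_zero_of_mem_sp1 {n : ℕ} {x y : g0 n} (hx : x ∈ sp1 n) {r : ℝ}
    (hy : ent 0 0 y.1 = r) : ⁅x, y⁆ = 0 := by
  refine ext_zero_g0 fun i j => ?_
  rw [coe_lie_g0, ent_lie, Finset.sum_eq_single 0, Finset.sum_eq_single 0]
  · by_cases hi : i = 0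
    · by_cases hj : j = 0
      · rw [hi, hj, hy, Quaternion.coe_commutes, sub_self]
      · rw [ent_g0_zero_left y hj, mem_spAt_iff.1 hx 0 j fun h => hj h.2, mul_zero, mul_zero,
          sub_zero]
    · rw [ent_g0_zero_right y hi, mem_spAt_iff.1 hx i 0 fun h => hi h.1, zero_mul, zero_mul,
          sub_zero]
  · intro k _ hk
    rw [mem_spAt_iff.1 hx k j fun h => hk h.1, mul_zero]
  · simp
  · intro k _ hk
    rw [mem_spAt_iff.1 hx i k fun h => hk h.2, zero_mul]
  · simp

/-- The defining property of the annihilator of the extremal element given by `P, Q, R`. -/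
def IsExtremalAnn {n : ℕ} (hn : 2 ≤ n) (P Q R : ℍ[ℝ]) (a : LieSubalgebra ℝ (g0 n)) : Prop :=
  ∀ X : g0 n, X ∈ a ↔ InParabolic hn X.1 ∧ StabEnt hn P Q R X.1

/-- The summand `𝔰𝔬(2)` of a subalgebra `𝔞`: its intersection with
`𝔰𝔭(1)_left ⊕ 𝔰𝔭(1)_right`. -/
def soPart {n : ℕ} (hn : 2 ≤ n) (a : LieSubalgebra ℝ (g0 n)) : LieSubalgebra ℝ (g0 n) :=
  spLR n hn ⊓ a

/-- The five summands of the annihilator. -/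
def summands {n : ℕ} (hn : 2 ≤ n) (a : LieSubalgebra ℝ (g0 n)) : Fin 5 → Submodule ℝ (g0 n) :=
  ![sp1 n, (soPart hn a).toSubmodule, Submodule.span ℝ {lineElt n hn},
    (glEmb n hn).range.toSubmodule, hplus n]

section

variable {n : ℕ} {hn : 2 ≤ n} {P Q R : ℍ[ℝ]} {a : LieSubalgebra ℝ (g0 n)}

theorem sp1_le (ha : IsExtremalAnn hn P Q R a) : sp1 n ≤ a.toSubmodule := by
  intro X hX
  have h10 := one_ne_zero' hn
  have hl0 := last_ne_zero' hn
  have hX' := mem_spAt_iff.1 hX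
  refine (ha X).2 ⟨⟨fun i _ => hX' _ _ fun h => h10 h.2, fun j _ => hX' _ _ fun h => hl0 h.1⟩, ?_⟩
  unfold StabEnt
  rw [hX' _ _ fun h => h10 h.1, hX' _ _ fun h => hl0 h.1]
  have h0 : (ent 0 0 X.1).re = 0 := re_of_mem_spAt hX
  rw [h0]
  exact stab_zero P Q R

theorem lineElt_mem (ha : IsExtremalAnn hn P Q R a) : lineElt n hn ∈ a := by
  refine (ha _).2 ⟨⟨fun i hi => by rw [ent_lineElt, if_neg hi],
    fun j hj => by rw [ent_lineElt, if_neg (Ne.symm hj)]⟩, ?_⟩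
  unfold StabEnt
  rw [ent_lineElt, ent_lineElt, ent_lineElt, if_pos rfl, if_pos rfl, if_pos rfl]
  exact stab_coe P Q R (lineDiag_stab n hn)

theorem glEmb_mem (ha : IsExtremalAnn hn P Q R a) (B : gl (n - 2)) : glEmb n hn B ∈ a := by
  refine (ha _).2 ⟨⟨fun i hi => by rw [ent_glEmb, glFun_one_right, if_neg hi],
    fun j hj => by rw [ent_glEmb, glFun_last_left, if_neg (Ne.symm hj)]⟩, ?_⟩
  unfold StabEnt
  rw [ent_glEmb, ent_glEmb, ent_glEmb, glFun_one_left, glFun_last_left, glFun_zero_left,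
    if_pos rfl, if_pos rfl]
  refine stab_coe P Q R ?_
  show -(3 / 4) * B.trace.re - 3 * (-(1 / 4) * B.trace.re) + 2 * 0 = 0
  ring

theorem hplus_le (ha : IsExtremalAnn hn P Q R a) : hplus n ≤ a.toSubmodule := by
  intro X hX
  have h1l := one_ne_last hn
  refine (ha X).2 ⟨⟨fun i hi => ent_hplus (hn := hn) hX fun h => ?_,
    fun j hj => ent_hplus (hn := hn) hX fun h => ?_⟩, ?_⟩
  · exact h.2.2.1.elim hi h1l
  · exact h.2.2.1.elim h1l.symm hj
  · unfold StabEnt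
    have hd : ∀ i, ent i i X.1 = 0 := fun i => ent_hplus (hn := hn) hX fun h => h.2.2.2 rfl
    rw [hd, hd, hd]
    exact stab_zero P Q R

theorem iSup_summands_le (ha : IsExtremalAnn hn P Q R a) :
    ⨆ i, summands hn a i ≤ a.toSubmodule := by
  refine iSup_le fun i => ?_
  fin_cases i
  · exact sp1_le ha
  · exact fun X hX => hX.2
  · show Submodule.span ℝ {lineElt n hn} ≤ _
    rw [Submodule.span_le, Set.singleton_subset_iff]
    exact lineElt_mem ha
  · rintro _ ⟨B, rfl⟩
    exact glEmb_mem ha B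
  · exact hplus_le ha

/-- After subtraction of a multiple of `lineElt`, the real parts of the diagonal entries outside of
the middle block are those of an element of the embedded `𝔤𝔩(n-2, ℍ)`. -/
theorem le_iSup_summands (hPQR : ¬(P = 0 ∧ Q = 0 ∧ R = 0)) (ha : IsExtremalAnn hn P Q R a) :
    a.toSubmodule ≤ ⨆ i, summands hn a i := by
  intro X hX
  have h10 := one_ne_zero' hn
  have hl0 := last_ne_zero' hn
  have h1l := one_ne_last hn
  have hle : ∀ i, summands hn a i ≤ ⨆ i, summands hn a i := le_iSup (summands hn a)
  set ρ : ℝ := (ent 0 0 X.1).re / lineDiag n hn 0 with hρ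
  set Y : g0 n := X - ρ • lineElt n hn with hY
  have hYa : Y ∈ a := sub_mem hX (a.smul_mem ρ (lineElt_mem ha))
  have hY0 : (ent 0 0 Y.1).re = 0 := by
    rw [← ent0_apply, hY, map_sub, map_smul, ent0_apply, ent0_apply, ent_lineElt, if_pos rfl]
    simp only [Quaternion.re_sub, Quaternion.re_smul, Quaternion.re_coe, smul_eq_mul]
    rw [hρ, div_mul_cancel₀ _ (lineDiag_zero_ne n hn), sub_self]
  obtain ⟨⟨hpar1, hpar2⟩, hst⟩ := (ha Y).1 hYa
  obtain ⟨hre, him⟩ := (stab_iff_im hPQR).1 hst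
  rw [hY0, mul_zero, add_zero] at hre
  set B := midBlock Y with hB
  have htr : B.trace.re = ∑ m, (ent (mid m) (mid m) Y.1).re := re_sum _ _
  have hsum := re_sum_diag Y.1
  rw [sum_index hn, hY0, ← htr, zero_add] at hsum
  let x1 : g0 n := diagIm (fun i => if i = 0 then (ent 0 0 Y.1).im else 0)
    fun i => by split_ifs <;> simp
  let x2 : g0 n := diagIm (fun i => if i = one n hn ∨ i = Fin.last n then (ent i i Y.1).im else 0)
    fun i => by split_ifs <;> simp
  have e1 : ∀ i j, ent i j x1.1 = if i = j then if i = 0 then (ent 0 0 Y.1).im else 0 else 0 :=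
    ent_diagIm _ _
  have e2 : ∀ i j, ent i j x2.1 = if i = j then
      if i = one n hn ∨ i = Fin.last n then (ent i i Y.1).im else 0 else 0 := ent_diagIm _ _
  have m1 : x1 ∈ sp1 n := mem_spAt_iff.2 fun i j hij => by
    rw [e1]
    split_ifs with h1 h2
    · exact absurd ⟨h2, h1 ▸ h2⟩ hij
    · rfl
    · rfl
  have m2' : x2 ∈ spLR n hn := ⟨fun i j hij => by
    rw [e2]
    split_ifs with h1 h2
    · exact absurd ⟨h1, h2⟩ hij
    · rfl
    · rfl, fun i => by
    rw [e2, if_pos rfl]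
    split_ifs <;> simp⟩
  have m2 : x2 ∈ soPart hn a := by
    refine ⟨m2', (ha _).2 ⟨⟨fun i hi => m2'.1 _ _ fun h => hi h.1,
      fun j hj => m2'.1 _ _ fun h => hj h.1.symm⟩, ?_⟩⟩
    unfold StabEnt
    rw [e2, e2, e2, if_pos rfl, if_pos rfl, if_pos rfl, if_pos (Or.inl rfl), if_pos (Or.inr rfl),
      if_neg fun h => h.elim h10.symm hl0.symm]
    exact him
  have hd : ∀ q : ℍ[ℝ], q - q.im = (q.re : ℍ[ℝ]) := fun q => by
    rw [sub_eq_iff_eq_add, Quaternion.re_add_im]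
  have m5 : Y - x1 - x2 - glEmb n hn B ∈ hplus n := by
    have e5 : ∀ i j, ent i j (Y - x1 - x2 - glEmb n hn B).1 =
        ent i j Y.1 - ent i j x1.1 - ent i j x2.1 - glFun n hn B i j := fun i j => by
      rw [← ent0_apply, map_sub, map_sub, map_sub]
      rfl
    refine (mem_hplus_iff hn).2 ⟨?_, fun i j hi hj hij => ?_⟩
    · rw [e5, e1, e2, glFun_zero_left, if_pos rfl, if_pos rfl, if_pos rfl,
        if_neg fun h => h.elim h10.symm hl0.symm, hd, hY0]
      simp
    · rw [e5, e1, e2, if_neg hi, ite_self, sub_zero]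
      rcases index_cases hn i with rfl | rfl | ⟨k, rfl⟩ | rfl
      · exact absurd rfl hi
      · have : one n hn = j := by
          by_contra h
          exact hij ⟨Or.inl rfl, h⟩
        subst this
        rw [if_pos rfl, if_pos (Or.inl rfl), hd, glFun_one_left, if_pos rfl, sub_eq_zero]
        congr 1
        linarith
      · rw [if_neg (show ¬(mid k = one n hn ∨ mid k = Fin.last n) from
          fun h => h.elim (mid_ne_one hn k) (mid_ne_last k)), ite_self, sub_zero]
        rcases index_cases hn j with rfl | rfl | ⟨l, rfl⟩ | rfl
        · exact absurd rfl hj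
        · rw [hpar1 _ (mid_ne_one hn k), glFun_one_right, if_neg (mid_ne_one hn k), sub_zero]
        · rw [glFun_mid, hB, midBlock_apply, sub_self]
        · exact absurd ⟨Or.inr rfl, mid_ne_last k⟩ hij
      · by_cases h : Fin.last n = j
        · subst h
          rw [if_pos rfl, if_pos (Or.inr rfl), hd, glFun_last_left, if_pos rfl, sub_eq_zero]
          congr 1
          linarith
        · rw [if_neg h, hpar2 _ (Ne.symm h), glFun_last_left, if_neg h, sub_zero, sub_zero]
  have e : X = x1 + x2 + ρ • lineElt n hn + glEmb n hn B + (Y - x1 - x2 - glEmb n hn B) := by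
    rw [hY]
    abel
  rw [e]
  exact add_mem (add_mem (add_mem (add_mem (hle 0 m1) (hle 1 m2))
    (hle 2 (Submodule.smul_mem _ ρ (Submodule.mem_span_singleton_self _))))
    (hle 3 ⟨B, rfl⟩)) (hle 4 m5)

theorem iSupIndep_summands : iSupIndep (summands hn a) := by
  have h10 := one_ne_zero' hn
  have hl0 := last_ne_zero' hn
  have h1l := one_ne_last hn
  refine iSupIndep_of_sum_eq_zero _ fun x hx hsum => ?_
  have hx0 : x 0 ∈ sp1 n := hx 0
  have hx1 : x 1 ∈ soPart hn a := hx 1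
  obtain ⟨c, hc⟩ := Submodule.mem_span_singleton.1
    (show x 2 ∈ Submodule.span ℝ {lineElt n hn} from hx 2)
  obtain ⟨B, hB⟩ := (show x 3 ∈ (glEmb n hn).range.toSubmodule from hx 3)
  have hx4 : x 4 ∈ hplus n := hx 4
  have hx0' := mem_spAt_iff.1 hx0
  have hx1' := hx1.1.1
  rw [Fin.sum_univ_five] at hsum
  have key : ∀ i j, ent i j (x 0).1 + ent i j (x 1).1 +
      c • (if i = j then (lineDiag n hn i : ℍ[ℝ]) else 0) + glFun n hn B i j
      + ent i j (x 4).1 = 0 := fun i j => by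
    have h := congrArg (ent0 i j) hsum
    rw [← hc, ← hB, map_add, map_add, map_add, map_add, map_smul, map_zero] at h
    simp only [ent0_apply, ent_lineElt] at h
    exact h
  have hd4 : ∀ i, ent i i (x 4).1 = 0 := fun i => ent_hplus (hn := hn) hx4 fun h => h.2.2.2 rfl
  have hc0 : c = 0 := by
    have h := key 0 0
    rw [hx1' _ _ fun h => h.2.elim h10.symm hl0.symm, glFun_zero_left, hd4, if_pos rfl] at h
    have h := congrArg (fun q : ℍ[ℝ] => q.re) h
    have h0 : (ent 0 0 (x 0).1).re = 0 := re_of_mem_spAt hx0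
    simp only [Quaternion.re_add, Quaternion.re_smul, Quaternion.re_zero, Quaternion.re_coe,
      add_zero, h0, zero_add, smul_eq_mul] at h
    exact (mul_eq_zero.1 h).resolve_right (lineDiag_zero_ne n hn)
  have hx2z : x 2 = 0 := by rw [← hc, hc0, zero_smul]
  simp only [hc0, zero_smul, add_zero] at key
  have hx0z : x 0 = 0 := ext_zero_g0 fun i j => by
    by_cases hij : i = 0 ∧ j = 0
    · have h := key 0 0
      rw [hx1' _ _ fun h => h.2.elim h10.symm hl0.symm, glFun_zero_left, hd4] at h
      rw [hij.1, hij.2]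
      simpa using h
    · exact hx0' i j hij
  have hB0 : B = 0 := by
    ext1 k l
    have h := key (mid k) (mid l)
    rw [hx0' _ _ fun h => mid_ne_zero k h.1,
      hx1' _ _ fun h => h.2.elim (mid_ne_one hn k) (mid_ne_last k), glFun_mid,
      ent_hplus (hn := hn) hx4 fun h => h.2.2.1.elim (mid_ne_one hn k) (mid_ne_last l)] at h
    simpa using h
  have hx3z : x 3 = 0 := by rw [← hB, hB0, map_zero]
  have hx1z : x 1 = 0 := ext_zero_g0 fun i j => by
    by_cases hij : i = j ∧ (i = one n hn ∨ i = Fin.last n)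
    · obtain ⟨rfl, hi⟩ := hij
      have hi0 : i ≠ 0 := by
        rcases hi with rfl | rfl
        exacts [h10, hl0]
      have hg : glFun n hn B i i = 0 := by
        rw [← ent_glEmb, hB0, map_zero]
        exact map_zero (ent i i)
      have h := key i i
      rw [hx0' _ _ fun h => hi0 h.1, hd4, hg] at h
      simpa using h
    · exact hx1' i j hij
  rw [hx0z, hx1z, hx2z, hx3z, zero_add, zero_add, zero_add, zero_add] at hsum
  intro i
  fin_cases i
  exacts [hx0z, hx1z, hx2z, hx3z, hsum]

theorem finrank_ann (hPQR : ¬(P = 0 ∧ Q = 0 ∧ R = 0)) (ha : IsExtremalAnn hn P Q R a) :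
    Module.finrank ℝ a =
      3 + Module.finrank ℝ (soPart hn a) + 1 + 4 * (n - 2) ^ 2 + (8 * n - 12) := by
  have h := finrank_iSup_eq_sum (summands hn a) iSupIndep_summands
  rw [le_antisymm (iSup_summands_le ha) (le_iSup_summands hPQR ha), Fin.sum_univ_five] at h
  have h2 : Module.finrank ℝ (summands hn a 2) = 1 := finrank_span_singleton (lineElt_ne_zero n hn)
  have h3 : Module.finrank ℝ (summands hn a 3) = 4 * (n - 2) ^ 2 := finrank_range_glEmb n hn
  have h4 : Module.finrank ℝ (summands hn a 4) = 8 * n - 12 := finrank_hplus hn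
  have h0 : Module.finrank ℝ (summands hn a 0) = 3 := finrank_sp1 n
  rw [h0, h2, h3, h4] at h
  exact h

/-- If the part in `𝔰𝔭(1)_left ⊕ 𝔰𝔭(1)_right` is one-dimensional, the annihilator of an extremal
element has the asserted shape. -/
theorem hasCurvatureShape (hPQR : ¬(P = 0 ∧ Q = 0 ∧ R = 0)) (ha : IsExtremalAnn hn P Q R a)
    (hk : Module.finrank ℝ (soPart hn a) = 1) :
    HasCurvatureShape n hn a (soPart hn a) (Submodule.span ℝ {lineElt n hn}) (glEmb n hn) := by
  have h10 := one_ne_zero' hn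
  have hl0 := last_ne_zero' hn
  have h1l := one_ne_last hn
  have h00 : ∀ x ∈ spLR n hn, ent 0 0 x.1 = 0 := fun x hx =>
    hx.1 0 0 fun h => h.2.elim h10.symm hl0.symm
  refine
    { so2 := le_trans (fun X hX => hX.1) (spLR_le n hn)
      so2_equiv := nonempty_lieEquiv_of_finrank_eq_one hk finrank_so_two
      line := ⟨2 * scale n, -1, lineElt_ne_zero n hn, rfl⟩
      gl_block := midBlock_glEmb hn
      indep := iSupIndep_summands
      sup_eq := le_antisymm (iSup_summands_le ha) (le_iSup_summands hPQR ha)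
      sp1_comm := fun x hx y hy => ?_
      so2_line := fun x hx y hy => ?_
      so2_gl := fun x hx B => ?_
      line_gl := fun x hx B => ?_
      ideal := fun x hx y hy => ?_ }
  · obtain ⟨z, hz, y4, hy4, rfl⟩ := Submodule.mem_sup.1 hy
    obtain ⟨z', hz', y3, ⟨B, rfl⟩, rfl⟩ := Submodule.mem_sup.1 hz
    obtain ⟨y1, hy1, y2, hy2, rfl⟩ := Submodule.mem_sup.1 hz'
    obtain ⟨c, rfl⟩ := Submodule.mem_span_singleton.1 hy2
    rw [lie_add, lie_add, lie_add, lie_smul,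
      lie_eq_zero_of_mem_sp1 (r := 0) hx ((h00 y1 hy1.1).trans Quaternion.coe_zero.symm),
      lie_eq_zero_of_mem_sp1 hx ((ent_lineElt hn 0 0).trans (if_pos rfl)),
      lie_eq_zero_of_mem_sp1 (r := 0) (y := y4) hx (hy4.1.trans Quaternion.coe_zero.symm)]
    have : ⁅x, glEmb n hn B⁆ = 0 := lie_eq_zero_of_mem_sp1 (r := 0) hx
      ((glFun_zero_left hn B 0).trans Quaternion.coe_zero.symm)
    rw [smul_zero, add_zero, add_zero, zero_add]
    exact this
  · obtain ⟨c, rfl⟩ := Submodule.mem_span_singleton.1 hy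
    rw [lie_smul, ← lie_skew]
    have : ⁅lineElt n hn, x⁆ = 0 := ext_zero_g0 fun i j => by
      rw [coe_lie_g0, ent_lineElt_lie]
      by_cases hij : i = j
      · rw [hij, sub_self, zero_smul]
      · rw [hx.1.1 i j fun h => hij h.1, smul_zero]
    rw [this, neg_zero, smul_zero]
  · refine ext_zero_g0 fun i j => ?_
    have hx' := hx.1.1
    rw [coe_lie_g0, ent_lie, Finset.sum_eq_single i, Finset.sum_eq_single j, ent_glEmb]
    · by_cases hi : i = one n hn ∨ i = Fin.last n
      · by_cases hij : i = j
        · subst hij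
          rcases hi with rfl | rfl
          · rw [glFun_one_left, if_pos rfl, Quaternion.coe_commutes, sub_self]
          · rw [glFun_last_left, if_pos rfl, Quaternion.coe_commutes, sub_self]
        · have : glFun n hn B i j = 0 := by
            rcases hi with rfl | rfl
            · rw [glFun_one_left, if_neg hij]
            · rw [glFun_last_left, if_neg hij]
          rw [this, mul_zero, zero_mul, sub_zero]
      · rw [hx' i i fun h => hi h.2, zero_mul, zero_sub, neg_eq_zero]
        by_cases hj : j = one n hn ∨ j = Fin.last n
        · have hij : i ≠ j := fun h => hi (h ▸ hj)
          have : glFun n hn B i j = 0 := by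
            rcases hj with rfl | rfl
            · rw [glFun_one_right, if_neg hij]
            · rw [glFun_last_right, if_neg hij]
          rw [this, zero_mul]
        · rw [hx' j j fun h => hj h.2, mul_zero]
    · intro k _ hk
      rw [hx' k j fun h => hk h.1, mul_zero]
    · simp
    · intro k _ hk
      rw [hx' i k fun h => hk h.1.symm, zero_mul]
    · simp
  · obtain ⟨c, rfl⟩ := Submodule.mem_span_singleton.1 hx
    rw [smul_lie]
    have : ⁅lineElt n hn, glEmb n hn B⁆ = 0 := ext_zero_g0 fun i j => by
      rw [coe_lie_g0, ent_lineElt_lie, ent_glEmb]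
      rcases index_cases hn i with rfl | rfl | ⟨k, rfl⟩ | rfl
      · rw [glFun_zero_left, smul_zero]
      · rw [glFun_one_left]
        split_ifs with h
        · rw [← h, sub_self, zero_smul]
        · rw [smul_zero]
      · rcases index_cases hn j with rfl | rfl | ⟨l, rfl⟩ | rfl
        · rw [glFun_zero_right, smul_zero]
        · rw [glFun_one_right, if_neg (mid_ne_one hn k), smul_zero]
        · rw [lineDiag_mid, lineDiag_mid, sub_self, zero_smul]
        · rw [glFun_last_right, if_neg (mid_ne_last k), smul_zero]
      · rw [glFun_last_left]
        split_ifs with h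
        · rw [← h, sub_self, zero_smul]
        · rw [smul_zero]
    rw [this, smul_zero]
  · obtain ⟨⟨hp1, hp2⟩, -⟩ := (ha x).1 hx
    refine (mem_hplus_iff hn).2 ⟨?_, fun i j hi hj hij => ?_⟩
    · rw [coe_lie_g0, ent_lie, Finset.sum_eq_zero, Finset.sum_eq_zero, sub_zero]
      · intro k _
        rw [ent_hplus (hn := hn) hy fun h => h.1 rfl, zero_mul]
      · intro k _
        rw [ent_hplus (hn := hn) hy fun h => h.2.1 rfl, mul_zero]
    · rw [coe_lie_g0, ent_lie, Finset.sum_eq_zero, Finset.sum_eq_zero, sub_zero]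
      · intro k _
        by_cases hk : i ≠ 0 ∧ k ≠ 0 ∧ (i = one n hn ∨ k = Fin.last n) ∧ i ≠ k
        · have : ent k j x.1 = 0 := by
            rcases hk.2.2.1 with h | h
            · have hj : j = one n hn := by
                by_contra hj
                exact hij ⟨Or.inl h, fun h' => hj (h' ▸ h)⟩
              rw [hj]
              exact hp1 k fun h' => hk.2.2.2 (h.trans h'.symm)
            · rw [h]
              refine hp2 j fun hj => hij ⟨Or.inr hj, fun h' => hk.2.2.2 ?_⟩
              rw [h', hj, h]
          rw [this, mul_zero]
        · rw [ent_hplus hy hk, zero_mul]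
      · intro k _
        by_cases hk : k ≠ 0 ∧ j ≠ 0 ∧ (k = one n hn ∨ j = Fin.last n) ∧ k ≠ j
        · have : ent i k x.1 = 0 := by
            rcases hk.2.2.1 with h | h
            · rw [h]
              refine hp1 i fun hi => hij ⟨Or.inl hi, fun h' => hk.2.2.2 ?_⟩
              rw [← h', hi, h]
            · have hi : i = Fin.last n := by
                by_contra hi
                exact hij ⟨Or.inr h, fun h' => hi (h' ▸ h)⟩
              rw [hi]
              exact hp2 k fun h' => hk.2.2.2 (h'.trans h.symm)
          rw [this, zero_mul]
        · rw [ent_hplus hy hk, mul_zero]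

theorem finrank_soPart_le (hPQR : ¬(P = 0 ∧ Q = 0 ∧ R = 0)) (h0 : P * qi + Q * qj + R * qk = 0)
    (ha : IsExtremalAnn hn P Q R a) : Module.finrank ℝ (soPart hn a) ≤ 1 :=
  finrank_spLR_inf_le hPQR h0 (soPart hn a) fun X hX => ⟨hX.1, ((ha X).1 hX.2).2⟩

/-- The weight vector `α = (0, 1, i)` is annihilated by the element `(3i, i)` of
`𝔰𝔭(1)_left ⊕ 𝔰𝔭(1)_right`. -/
theorem one_le_finrank_soPart (ha : IsExtremalAnn hn 0 1 qi a) :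
    1 ≤ Module.finrank ℝ (soPart hn a) := by
  have h10 := one_ne_zero' hn
  have hl0 := last_ne_zero' hn
  have h1l := one_ne_last hn
  let X : g0 n := diagIm (fun i => if i = one n hn then (3 : ℝ) • qi else
    if i = Fin.last n then qi else 0) fun i => by split_ifs <;> simp
  have e : ∀ i j, ent i j X.1 = if i = j then if i = one n hn then (3 : ℝ) • qi else
    if i = Fin.last n then qi else 0 else 0 := ent_diagIm _ _
  have m1 : X ∈ spLR n hn := by
    refine ⟨fun i j hij => ?_, fun i => ?_⟩
    · rw [e]
      split_ifs with h1 h2 h3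
      · exact absurd ⟨h1, Or.inl h2⟩ hij
      · exact absurd ⟨h1, Or.inr h3⟩ hij
      · rfl
      · rfl
    · rw [e, if_pos rfl]
      split_ifs <;> simp
  have m2 : X ∈ soPart hn a := by
    refine ⟨m1, (ha X).2 ⟨⟨fun i hi => m1.1 _ _ fun h => hi h.1,
      fun j hj => m1.1 _ _ fun h => hj h.1.symm⟩, ?_⟩⟩
    unfold StabEnt
    rw [e, e, e, if_pos rfl, if_pos rfl, if_pos rfl, if_pos rfl, if_neg h1l.symm, if_pos rfl,
      if_neg h10.symm, if_neg hl0.symm, stab_iff]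
    refine ⟨?_, ?_, ?_⟩ <;> ext <;> simp <;> norm_num
  have hX : X ≠ 0 := fun h => by
    have h2 : ent (Fin.last n) (Fin.last n) X.1 = 0 := by
      rw [h]
      exact map_zero (ent _ _)
    rw [e, if_pos rfl, if_neg h1l.symm, if_pos rfl] at h2
    have := congrArg (fun q : ℍ[ℝ] => q.imI) h2
    simp at this
  have : Nontrivial (soPart hn a) := ⟨⟨⟨X, m2⟩, 0, fun h => hX (congrArg Subtype.val h)⟩⟩
  have hfin : Module.Finite ℝ (soPart hn a) :=
    inferInstanceAs (Module.Finite ℝ (soPart hn a).toSubmodule)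
  exact Module.finrank_pos

end

/-! ### Annihilators of largest dimension -/

section

variable {n : ℕ} {hn : 2 ≤ n}

theorem isExtremalAnn_topClass {P Q R : ℍ[ℝ]} (hPQR : ¬(P = 0 ∧ Q = 0 ∧ R = 0))
    (h : topCochain n hn (weylForm P Q R) ∈ cocycles₂ (grading n)) :
    IsExtremalAnn hn P Q R (ann (grading n) (topClass hn _ h)) :=
  mem_ann_iff hn hPQR h

theorem finrank_ann_le {w : CurvatureModule n} (hw : IsExtremal n hn w) (h0 : w ≠ 0) :
    Module.finrank ℝ (ann (grading n) w) ≤ 3 + 1 + 1 + 4 * (n - 2) ^ 2 + (8 * n - 12) := by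
  obtain ⟨P, Q, R, h, hrel, hPQR, rfl⟩ := hw.exists_weylForm h0
  have ha := isExtremalAnn_topClass hPQR h
  have h1 := finrank_ann hPQR ha
  have h2 := finrank_soPart_le hPQR hrel ha
  exact h1.trans_le (by omega)

theorem exists_finrank_ann_eq : ∃ w : CurvatureModule n, IsExtremal n hn w ∧ w ≠ 0 ∧
    3 + 1 + 1 + 4 * (n - 2) ^ 2 + (8 * n - 12) ≤ Module.finrank ℝ (ann (grading n) w) := by
  have hPQR : ¬((0 : ℍ[ℝ]) = 0 ∧ (1 : ℍ[ℝ]) = 0 ∧ qi = 0) := by simp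
  have h := weylForm_example_mem hn
  have ha := isExtremalAnn_topClass hPQR h
  refine ⟨topClass hn _ h, (isExtremal_iff hn _).2 (lie_gradZ'_topClass hn h),
    fun h0 => weylForm_ne_zero hPQR ((topClass_eq_zero_iff h).1 h0), ?_⟩
  have h1 := finrank_ann hPQR ha
  have h2 := one_le_finrank_soPart ha
  exact le_trans (by omega) h1.ge

theorem exists_hasLargestAnn : ∃ w, HasLargestAnn n hn w := by
  obtain ⟨w, hw, h0, hle⟩ := exists_finrank_ann_eq (n := n) (hn := hn)
  exact ⟨w, hw, h0, fun w' hw' h0' => (finrank_ann_le hw' h0').trans hle⟩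

theorem HasLargestAnn.shape {w : CurvatureModule n} (hw : HasLargestAnn n hn w) :
    (∃ k r e, HasCurvatureShape n hn (ann (grading n) w) k r e) ∧
      Module.finrank ℝ (ann (grading n) w) = 3 + 1 + 1 + 4 * (n - 2) ^ 2 + (8 * n - 12) := by
  obtain ⟨he, h0, hmax⟩ := hw
  obtain ⟨w', hw', h0', hle⟩ := exists_finrank_ann_eq (n := n) (hn := hn)
  have hge := hle.trans (hmax w' hw' h0')
  have heq := le_antisymm (finrank_ann_le he h0) hge
  refine ⟨?_, heq⟩
  obtain ⟨P, Q, R, h, hrel, hPQR, rfl⟩ := he.exists_weylForm h0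
  have ha := isExtremalAnn_topClass hPQR h
  have h1 := (finrank_ann hPQR ha).symm.trans heq
  exact ⟨_, _, _, hasCurvatureShape hPQR ha (by omega)⟩

end

end AlmostQuaternionic

end

theorem mainTheorem4 (n : ℕ) (hn : 2 ≤ n) :
    (∃ w, AlmostQuaternionic.HasLargestAnn n hn w) ∧
    (∀ w, AlmostQuaternionic.HasLargestAnn n hn w →
      (∃ k r e, AlmostQuaternionic.HasCurvatureShape n hn (AlmostQuaternionic.ann (AlmostQuaternionic.grading n) w) k r e) ∧
      (Module.finrank ℝ
        (AlmostQuaternionic.gradedSum (AlmostQuaternionic.grading n) (AlmostQuaternionic.ann (AlmostQuaternionic.grading n) w)) : ℤ) =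
          4 * (n : ℤ) ^ 2 - 4 * n + 9) ∧
    (Module.finrank ℝ (AlmostQuaternionic.heis n) : ℤ) = 8 * (n : ℤ) - 12 := by
  have hcast : ((8 * n - 12 : ℕ) : ℤ) = 8 * n - 12 := by omega
  refine ⟨AlmostQuaternionic.exists_hasLargestAnn, fun w hw => ⟨hw.shape.1, ?_⟩, ?_⟩
  · have h := (AlmostQuaternionic.finrank_gradedSum _).trans
      (congrArg (fun d => 4 * n + d) hw.shape.2)
    refine (congrArg (fun d : ℕ => (d : ℤ)) h).trans ?_
    push_cast [hcast, Nat.cast_sub hn]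
    ring
  · rw [AlmostQuaternionic.finrank_heis hn, hcast]
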